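/- Let $n\ge 1$ and let $C$ be a symmetric convex body in $\mathbb{R}^n$, i.e. a compact convex set with non-empty interior and $C=-C$. Write $|K|$ for the volume of a set $K$, and $|\partial K|$ for its surface area, i.e. the $(n-1)$-dimensional Hausdorff measure of its boundary, normalised to agree with Lebesgue measure on $\mathbb{R}^{n-1}$. An affine image of $C$ is its image under an invertible affine map of $\mathbb{R}^n$; it is in John position if the Euclidean unit ball is an ellipsoid of maximal volume among all ellipsoids included in it. (i) For every $n$-dimensional cube $Q$ in $\mathbb{R}^n$ there is an affine image $\widetilde C$ of $C$ satisfying $$|\widetilde C| = |Q| \quad\text{and}\quad |\partial\widetilde C| \le |\partial Q|.$$ (ii) There is an affine image of $C$ in John position, and every affine image $\widetilde C$ of $C$ in John position satisfies $$|\partial \widetilde C| \le 2n\,|\widetilde C|^{(n-1)/n}.$$ -/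

import Mathlib

open MeasureTheory

/-- The surface area `|∂K|` of `K ⊆ ℝⁿ`: the `(n-1)`-dimensional Hausdorff measure of the
topological boundary of `K`, normalised to agree with Lebesgue measure on `ℝⁿ⁻¹`. -/
noncomputable def surfaceArea {n : ℕ} (K : Set (EuclideanSpace ℝ (Fin n))) : ENNReal :=
  Measure.euclideanHausdorffMeasure (n - 1) (frontier K)

/-- An `n`-dimensional cube in `ℝⁿ`: an isometric image of `[0, s]ⁿ` for some side length
`s > 0`. -/
def IsCube {n : ℕ} (Q : Set (EuclideanSpace ℝ (Fin n))) : Prop :=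
  ∃ s : ℝ, 0 < s ∧
    ∃ g : EuclideanSpace ℝ (Fin n) ≃ᵃⁱ[ℝ] EuclideanSpace ℝ (Fin n),
      Q = g '' {x | ∀ i, x i ∈ Set.Icc 0 s}

/-- A solid ellipsoid in `ℝⁿ`: the image of the closed Euclidean unit ball under an invertible
affine map. -/
def IsEllipsoid {n : ℕ} (E : Set (EuclideanSpace ℝ (Fin n))) : Prop :=
  ∃ ψ : EuclideanSpace ℝ (Fin n) ≃ᵃ[ℝ] EuclideanSpace ℝ (Fin n),
    E = ψ '' Metric.closedBall 0 1

/-- `K` is in John position: the closed Euclidean unit ball is an ellipsoid of maximal volume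
included in `K`. -/
def InJohnPosition {n : ℕ} (K : Set (EuclideanSpace ℝ (Fin n))) : Prop :=
  Metric.closedBall 0 1 ⊆ K ∧
    ∀ E : Set (EuclideanSpace ℝ (Fin n)), IsEllipsoid E → E ⊆ K →
      volume E ≤ volume (Metric.closedBall (0 : EuclideanSpace ℝ (Fin n)) 1)

/-! The proof is K. Ball's: two estimates for a convex body K whose maximal ellipsoid is the unit
ball.

First, |∂K| ≤ n|K| as soon as K contains the unit ball. For a polytope P ⊇ K, every bounding
hyperplane has distance at least 1 from the origin, so prisms of height ε erected on the facets are
disjoint from P and from each other and stay inside (1+ε)P. Hence |P| + ε|∂P| ≤ (1+ε)^n |P|, and ε →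
0 gives |∂P| ≤ n|P| (`volume_add_sum_face_le`, `le_of_forall_add_mul_le`). Nearest point projection
onto K does not increase area, so |∂K| ≤ |∂P|, and P may be taken inside rK with r → 1.

Second, |K| ≤ 2^n when K is symmetric. John's theorem
(`InJohnPosition.exists_isIdentityDecomposition`) gives unit vectors with ∑ c_k u_k ⊗ u_k = 1 and K
inside the slabs |⟪u_k, x⟫| ≤ 1. The geometric Brascamp-Lieb inequality, proved by transport to a
Gaussian (`volume_slabs_le`), bounds the intersection of the slabs by the volume of the cube
[-1,1]^n.

Together, |∂K| ≤ n |K|^(1/n) |K|^((n-1)/n) ≤ 2n |K|^((n-1)/n), which is (ii); existence of a John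
position is a compactness argument. A cube of side s has volume s^n and area at least 2n s^(n-1), so
(i) follows by rescaling a John position. -/

open Filter Topology Module
open scoped Pointwise

/-! ### Surface area of convex bodies: monotonicity, and area at most n times volume -/

section Surface

theorem IsPreconnected.nonempty_inter_frontier {X : Type*} [TopologicalSpace X] {s t : Set X}
    (hs : IsPreconnected s) (h : (s ∩ t).Nonempty) (h' : (s ∩ tᶜ).Nonempty) :
    (s ∩ frontier t).Nonempty := by
  by_contra hne
  rw [Set.not_nonempty_iff_eq_empty, ← Set.disjoint_iff_inter_eq_empty] at hne
  have key : ∀ x ∈ s, x ∉ frontier t := fun x hx hx' => Set.disjoint_left.1 hne hx hx'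
  have h1 : ∀ x ∈ s, x ∈ t → x ∈ interior t := by
    intro x hx hxt
    by_contra hc
    exact key x hx ⟨subset_closure hxt, hc⟩
  have h2 : ∀ x ∈ s, x ∉ t → x ∈ (closure t)ᶜ := by
    intro x hx hxt hc
    exact key x hx ⟨hc, fun h => hxt (interior_subset h)⟩
  obtain ⟨a, ha, hat⟩ := h
  obtain ⟨b, hb, hbt⟩ := h'
  obtain ⟨c, -, hc, hc'⟩ := hs _ _ isOpen_interior isClosed_closure.isOpen_compl
    (fun x hx => by
      by_cases hxt : x ∈ t
      · exact Or.inl (h1 x hx hxt)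
      · exact Or.inr (h2 x hx hxt)) ⟨a, ha, h1 a ha hat⟩ ⟨b, hb, h2 b hb hbt⟩
  exact hc' (interior_subset_closure hc)

variable {V : Type*} [NormedAddCommGroup V] [InnerProductSpace ℝ V]

/-- The nearest point projection onto a nonempty compact convex set. -/
theorem exists_nearest_point_projection {K : Set V} (hK : IsCompact K) (hc : Convex ℝ K)
    (hne : K.Nonempty) :
    ∃ π : V → V, LipschitzWith 1 π ∧
      ∀ z y, y ∈ K → (∀ w ∈ K, inner ℝ (z - y) (w - y) ≤ 0) → π z = y := by
  have h1 : ∀ z : V, ∃ v ∈ K, ∀ w ∈ K, inner ℝ (z - v) (w - v) ≤ 0 := by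
    intro z
    obtain ⟨v, hv, h⟩ := exists_norm_eq_iInf_of_complete_convex hne hK.isComplete hc z
    exact ⟨v, hv, (norm_eq_iInf_iff_real_inner_le_zero hc hv).1 h⟩
  choose π hπ hin using h1
  refine ⟨π, ?_, ?_⟩
  · refine LipschitzWith.of_dist_le_mul fun x y => ?_
    rw [NNReal.coe_one, one_mul, dist_eq_norm, dist_eq_norm]
    have a := hin x (π y) (hπ y)
    have b := hin y (π x) (hπ x)
    -- Sum of the two variational inequalities; Cauchy-Schwarz then yields the Lipschitz constant 1.
    have e : ‖π x - π y‖ ^ 2 ≤ inner ℝ (x - y) (π x - π y) := by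
      rw [← real_inner_self_eq_norm_sq]
      simp only [inner_sub_left, inner_sub_right] at a b ⊢
      linarith
    have f := real_inner_le_norm (x - y) (π x - π y)
    by_contra! hlt
    have : 0 < ‖π x - π y‖ := lt_of_le_of_lt (norm_nonneg _) hlt
    nlinarith
  · intro z y hy h
    have a := hin z y hy
    have b := h (π z) (hπ z)
    rw [← sub_eq_zero, ← norm_eq_zero, ← sq_eq_zero_iff]
    refine le_antisymm ?_ (sq_nonneg _)
    rw [← real_inner_self_eq_norm_sq]
    simp only [inner_sub_left, inner_sub_right] at a b ⊢
    linarith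

/-- Hahn-Banach separates `y` from the open set `interior K`, and the weak inequality passes to `K`,
which lies in the closure of its interior. For `y` on the boundary this is a supporting hyperplane.
-/
theorem Convex.exists_unit_normal [CompleteSpace V] {K : Set V} (hc : Convex ℝ K)
    (hne : (interior K).Nonempty) {y : V} (hy : y ∉ interior K) :
    ∃ ν : V, ‖ν‖ = 1 ∧ ∀ x ∈ K, inner ℝ ν x ≤ inner ℝ ν y := by
  obtain ⟨f, hf⟩ := geometric_hahn_banach_open_point hc.interior isOpen_interior hy
  set u := (InnerProductSpace.toDual ℝ V).symm f
  have hu : ∀ x, inner ℝ u x = f x := fun x => InnerProductSpace.toDual_symm_apply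
  have hcl : ∀ x ∈ K, f x ≤ f y := by
    intro x hx
    have : x ∈ closure (interior K) := by
      rw [hc.closure_interior_eq_closure_of_nonempty_interior hne]
      exact subset_closure hx
    exact closure_minimal (fun z hz => (hf z hz).le)
      (isClosed_le f.continuous continuous_const) this
  have hu0 : u ≠ 0 := by
    intro h0
    obtain ⟨a, ha⟩ := hne
    have := hf a ha
    rw [← hu, ← hu, h0] at this
    simp at this
  refine ⟨‖u‖⁻¹ • u, by simp [norm_smul, hu0], fun x hx => ?_⟩
  rw [inner_smul_left, inner_smul_left, hu, hu]
  exact mul_le_mul_of_nonneg_left (hcl x hx) (by simp)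

/-- The intersection of the half-spaces `⟪p.1, x⟫ ≤ p.2`. -/
def halfspaceInter (s : Finset (V × ℝ)) : Set V := {x | ∀ p ∈ s, inner ℝ p.1 x ≤ p.2}

theorem isClosed_halfspaceInter (s : Finset (V × ℝ)) : IsClosed (halfspaceInter s) := by
  have : halfspaceInter s = ⋂ p ∈ s, {x | inner ℝ p.1 x ≤ p.2} := by
    ext; simp [halfspaceInter]
  rw [this]
  exact isClosed_biInter fun p _ => isClosed_le (by fun_prop) continuous_const

theorem convex_halfspaceInter (s : Finset (V × ℝ)) : Convex ℝ (halfspaceInter s) := by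
  have : halfspaceInter s = ⋂ p ∈ s, {x | inner ℝ p.1 x ≤ p.2} := by
    ext; simp [halfspaceInter]
  rw [this]
  exact convex_iInter₂ fun p _ => convex_halfSpace_le (innerSL ℝ p.1).isLinear _

/-- The face of `halfspaceInter s` on the bounding hyperplane of `p`. -/
def halfspaceFace (s : Finset (V × ℝ)) (p : V × ℝ) : Set V :=
  {x ∈ halfspaceInter s | inner ℝ p.1 x = p.2}

theorem isClosed_halfspaceFace (s : Finset (V × ℝ)) (p : V × ℝ) :
    IsClosed (halfspaceFace s p) :=
  (isClosed_halfspaceInter s).inter (isClosed_eq (by fun_prop) continuous_const)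

theorem frontier_halfspaceInter_subset (s : Finset (V × ℝ)) :
    frontier (halfspaceInter s) ⊆ ⋃ p ∈ s, halfspaceFace s p := by
  intro x hx
  have hxP : x ∈ halfspaceInter s := (isClosed_halfspaceInter s).frontier_subset hx
  by_contra hcon
  simp only [Set.mem_iUnion, not_exists] at hcon
  refine hx.2 ?_
  rw [mem_interior]
  refine ⟨⋂ p ∈ s, {x | inner ℝ p.1 x < p.2}, ?_, ?_, ?_⟩
  · intro z hz p hp
    simp only [Set.mem_iInter] at hz
    exact (hz p hp).le
  · exact isOpen_biInter_finset fun p _ => isOpen_lt (by fun_prop) continuous_const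
  · simp only [Set.mem_iInter]
    exact fun p hp => lt_of_le_of_ne (hxP p hp) fun h => hcon p hp ⟨hxP, h⟩

/-- A compact convex set with the origin in its interior is approximated from outside by
polytopes. -/
theorem exists_halfspaceInter_between [FiniteDimensional ℝ V] {K : Set V} (hK : IsCompact K)
    (hc : Convex ℝ K) (h0 : (0 : V) ∈ interior K) {r : ℝ} (hr : 1 < r) :
    ∃ s : Finset (V × ℝ), (∀ p ∈ s, ‖p.1‖ = 1) ∧ K ⊆ halfspaceInter s ∧
      halfspaceInter s ⊆ r • K := by
  have hr0 : r ≠ 0 := by positivity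
  have hfr : IsCompact (frontier (r • K)) := (hK.smul r).of_isClosed_subset isClosed_frontier
    (hK.smul r).isClosed.frontier_subset
  have h1 : ∀ z ∈ frontier (r • K), ∃ p : V × ℝ, ‖p.1‖ = 1 ∧ (∀ x ∈ K, inner ℝ p.1 x ≤ p.2) ∧
      p.2 < inner ℝ p.1 z := by
    intro z hz
    have hint : (interior K).Nonempty := ⟨0, h0⟩
    have hy : r⁻¹ • z ∉ interior K := by
      intro h
      refine hz.2 ?_
      rw [interior_smul₀ hr0]
      exact (Set.mem_smul_set_iff_inv_smul_mem₀ hr0 _ _).2 h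
    obtain ⟨ν, hν, hsup⟩ := hc.exists_unit_normal hint hy
    refine ⟨(ν, inner ℝ ν (r⁻¹ • z)), hν, hsup, ?_⟩
    have hpos : 0 < inner ℝ ν (r⁻¹ • z) := by
      obtain ⟨ε, hε, hb⟩ := Metric.isOpen_iff.1 isOpen_interior _ h0
      have : (ε / 2) • ν ∈ K := interior_subset (hb (by
        simp [norm_smul, hν, abs_of_pos hε]; linarith))
      have := hsup _ this
      rw [inner_smul_right, real_inner_self_eq_norm_sq, hν] at this
      linarith
    have hz' : inner ℝ ν z = r * inner ℝ ν (r⁻¹ • z) := by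
      rw [inner_smul_right]; field_simp
    simp only [hz']
    nlinarith
  choose! p hp1 hp2 hp3 using h1
  -- Each boundary point of `r • K` is strictly cut off by a half-space containing `K`; by
  -- compactness finitely many of them cut off the whole boundary.
  obtain ⟨t, htsub, ht⟩ := hfr.elim_nhds_subcover (fun z => {x | (p z).2 < inner ℝ (p z).1 x})
    (fun z hz => (isOpen_lt continuous_const (by fun_prop)).mem_nhds (hp3 z hz))
  classical
  refine ⟨t.image p, ?_, ?_, ?_⟩
  · intro q hq
    obtain ⟨z, hz, rfl⟩ := Finset.mem_image.1 hq
    exact hp1 z (htsub z hz)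
  · intro x hx q hq
    obtain ⟨z, hz, rfl⟩ := Finset.mem_image.1 hq
    exact hp2 z (htsub z hz) x hx
  · intro x hx
    by_contra hxr
    have h0P : (0 : V) ∈ halfspaceInter (t.image p) := by
      intro q hq
      obtain ⟨z, hz, rfl⟩ := Finset.mem_image.1 hq
      exact hp2 z (htsub z hz) 0 (interior_subset h0)
    -- If `x` were outside `r • K`, this segment would cross the boundary of `r • K`, all of which
    -- has been cut off.
    have hseg : segment ℝ 0 x ⊆ halfspaceInter (t.image p) :=
      (convex_halfspaceInter _).segment_subset h0P hx
    obtain ⟨z, hz, hzf⟩ := (convex_segment (𝕜 := ℝ) (0 : V) x).isPreconnected.nonempty_inter_frontier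
      (t := r • K) ⟨0, left_mem_segment _ _ _,
        (Set.mem_smul_set_iff_inv_smul_mem₀ hr0 _ _).2 (by simpa using interior_subset h0)⟩
      ⟨x, right_mem_segment _ _ _, hxr⟩
    have := ht hzf
    simp only [Set.mem_iUnion] at this
    obtain ⟨w, hw, hlt⟩ := this
    exact absurd (hseg hz (p w) (Finset.mem_image_of_mem _ hw)) (not_le.2 hlt)

variable [MeasurableSpace V] [BorelSpace V]

/-- The open prism of height `ε` over a set in the hyperplane `⟪ν, x⟫ = h`. -/
def prismOver (ν : V) (h ε : ℝ) (F : Set V) : Set V :=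
  {x | inner ℝ ν x - h ∈ Set.Ioo 0 ε ∧ x - (inner ℝ ν x - h) • ν ∈ F}

theorem measurableSet_prismOver (ν : V) (h ε : ℝ) {F : Set V} (hF : MeasurableSet F) :
    MeasurableSet (prismOver ν h ε F) :=
  (measurableSet_Ioo.preimage (f := fun x : V => inner ℝ ν x - h)
    (Continuous.measurable (by fun_prop))).inter
    (hF.preimage (f := fun x : V => x - (inner ℝ ν x - h) • ν)
      (Continuous.measurable (by fun_prop)))

variable [FiniteDimensional ℝ V]

theorem LipschitzWith.euclideanHausdorffMeasure_image_le {X Y : Type*} [EMetricSpace X]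
    [MeasurableSpace X] [BorelSpace X] [EMetricSpace Y] [MeasurableSpace Y] [BorelSpace Y]
    {f : X → Y} (hf : LipschitzWith 1 f) (d : ℕ) (s : Set X) :
    μHE[d] (f '' s) ≤ μHE[d] s := by
  rw [Measure.euclideanHausdorffMeasure_def, Measure.euclideanHausdorffMeasure_def,
    Measure.smul_apply, Measure.smul_apply]
  have := hf.hausdorffMeasure_image_le (d := d) (by positivity) s
  simp only [ENNReal.coe_one, ENNReal.one_rpow, one_mul] at this
  gcongr

/-- The boundary of a convex body has at most the area of the boundary of a larger one. -/
theorem euclideanHausdorffMeasure_frontier_mono {K P : Set V} (hK : IsCompact K)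
    (hc : Convex ℝ K) (hne : (interior K).Nonempty) (hP : Bornology.IsBounded P) (hKP : K ⊆ P)
    (d : ℕ) : μHE[d] (frontier K) ≤ μHE[d] (frontier P) := by
  obtain ⟨π, hπ, huniq⟩ := exists_nearest_point_projection hK hc (hne.mono interior_subset)
  refine (measure_mono ?_).trans (hπ.euclideanHausdorffMeasure_image_le d _)
  intro y hy
  have hyK : y ∈ K := hK.isClosed.frontier_subset hy
  obtain ⟨ν, hν, hsup⟩ := hc.exists_unit_normal hne hy.2
  obtain ⟨R, hR⟩ := hP.subset_closedBall 0
  -- The outward normal ray at `y` starts in the bounded set `P` and leaves it, so it meets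
  -- `frontier P`; every point of this ray has `y` as its nearest point in `K`.
  have hconn : IsPreconnected ((fun t : ℝ => y + t • ν) '' Set.Ici 0) :=
    (convex_Ici (𝕜 := ℝ) 0).isPreconnected.image _ (by fun_prop)
  obtain ⟨z, ⟨t, ht, rfl⟩, hz⟩ := hconn.nonempty_inter_frontier (t := P)
    ⟨y, ⟨0, by simp, by simp⟩, hKP hyK⟩
    ⟨y + (|R| + ‖y‖ + 1) • ν, ⟨|R| + ‖y‖ + 1, by simp; positivity, rfl⟩, by
      intro hmem
      have h1 := hR hmem
      rw [mem_closedBall_zero_iff] at h1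
      have h2 : ‖(|R| + ‖y‖ + 1) • ν‖ = |R| + ‖y‖ + 1 := by
        rw [norm_smul, hν, mul_one, Real.norm_of_nonneg (by positivity)]
      have h3 : ‖(|R| + ‖y‖ + 1) • ν‖ ≤ ‖y + (|R| + ‖y‖ + 1) • ν‖ + ‖y‖ := by
        have := norm_sub_le (y + (|R| + ‖y‖ + 1) • ν) y
        simpa using this
      have := le_abs_self R
      linarith⟩
  refine ⟨_, hz, huniq _ y hyK fun w hw => ?_⟩
  have := hsup w hw
  rw [add_sub_cancel_left, inner_smul_left, inner_sub_right]
  exact mul_nonpos_of_nonneg_of_nonpos (by simpa using ht) (by linarith)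

/-- Fubini along `ν`: the slices at heights in `(0, ε)` are translates of `F`, the others are empty.
-/
theorem volume_prismOver {ν : V} (hν : ‖ν‖ = 1) (h ε : ℝ) {F : Set V} (hF : MeasurableSet F)
    (hFh : ∀ x ∈ F, inner ℝ ν x = h) :
    volume (prismOver ν h ε F) = ENNReal.ofReal ε * μHE[finrank ℝ V - 1] F := by
  have hν0 : ν ≠ 0 := by rintro rfl; simp at hν
  have hνν : inner ℝ ν ν = 1 := by rw [real_inner_self_eq_norm_sq, hν, one_pow]
  rw [← InnerProductSpace.euclideanHausdorffMeasure_eq_volume,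
    EuclideanGeometry.euclideanHausdorffMeasure_eq_lintegral (h • ν) hν0
      (measurableSet_prismOver ν h ε hF)]
  have hslice : ∀ t : ℝ, μHE[finrank ℝ V - 1] (prismOver ν h ε F ∩
      (AffineSubspace.mk' (t • ν +ᵥ h • ν) (Submodule.span ℝ {ν})ᗮ : Set V)) =
      (Set.Ioo 0 ε).indicator (fun _ => μHE[finrank ℝ V - 1] F) t := by
    intro t
    have hmem : ∀ x : V, x ∈ (AffineSubspace.mk' (t • ν +ᵥ h • ν) (Submodule.span ℝ {ν})ᗮ : Set V)
        ↔ inner ℝ ν x - h = t := by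
      intro x
      rw [SetLike.mem_coe, AffineSubspace.mem_mk', Submodule.mem_orthogonal_singleton_iff_inner_right]
      simp only [vsub_eq_sub, vadd_eq_add, inner_sub_right, inner_add_right, inner_smul_right, hνν]
      constructor <;> intro h <;> linarith
    by_cases ht : t ∈ Set.Ioo 0 ε
    · rw [Set.indicator_of_mem ht, ← measure_vadd μHE[finrank ℝ V - 1] (t • ν) F]
      congr 1
      ext x
      rw [Set.mem_inter_iff, hmem, Set.mem_vadd_set_iff_neg_vadd_mem]
      simp only [prismOver, Set.mem_ofPred_eq, vadd_eq_add]
      constructor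
      · rintro ⟨⟨-, h2⟩, h3⟩
        rw [h3] at h2
        rwa [neg_add_eq_sub]
      · intro hx
        have h1 := hFh _ hx
        rw [inner_add_right, inner_neg_right, inner_smul_right, hνν] at h1
        have h2 : inner ℝ ν x - h = t := by linarith
        rw [h2]
        exact ⟨⟨ht, by rwa [← neg_add_eq_sub]⟩, rfl⟩
    · rw [Set.indicator_of_notMem ht]
      convert measure_empty (μ := μHE[finrank ℝ V - 1])
      ext x
      rw [Set.mem_inter_iff, hmem]
      simp only [Set.mem_empty_iff_false, iff_false]
      rintro ⟨⟨h1, -⟩, h3⟩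
      rw [h3] at h1
      exact ht h1
  simp_rw [hslice]
  rw [lintegral_indicator measurableSet_Ioo]
  simp [← ofReal_norm, hν, mul_comm]

/-- The prisms over the faces of a polytope that contains the unit ball lie disjointly between the
polytope and a dilate of it. -/
theorem volume_add_sum_face_le {s : Finset (V × ℝ)} (hs : ∀ p ∈ s, ‖p.1‖ = 1)
    (hB : Metric.closedBall 0 1 ⊆ halfspaceInter s) {ε : ℝ} (hε : 0 < ε) :
    volume (halfspaceInter s) +
      ENNReal.ofReal ε * ∑ p ∈ s, μHE[finrank ℝ V - 1] (halfspaceFace s p) ≤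
      ENNReal.ofReal ((1 + ε) ^ finrank ℝ V) * volume (halfspaceInter s) := by
  set P := halfspaceInter s with hP
  have hmeas : ∀ p, MeasurableSet (prismOver p.1 p.2 ε (halfspaceFace s p)) := fun p =>
    measurableSet_prismOver _ _ _ (isClosed_halfspaceFace s p).measurableSet
  have hdisj : (s : Set (V × ℝ)).PairwiseDisjoint
      (fun p => prismOver p.1 p.2 ε (halfspaceFace s p)) := by
    intro p hp q hq hpq
    refine Set.disjoint_left.2 fun x hx hx' => hpq ?_
    obtain ⟨⟨a0, -⟩, ⟨aP, ah⟩⟩ := hx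
    obtain ⟨⟨b0, -⟩, ⟨bP, bh⟩⟩ := hx'
    set a := inner ℝ p.1 x - p.2 with ha
    set b := inner ℝ q.1 x - q.2 with hb
    have e1 := aP q hq
    have e2 := bP p hp
    -- Both feet lie in `P` with the displacement to `x` as outer normal, so both are the nearest
    -- point of `P` to `x`.
    have hy : x - a • p.1 = x - b • q.1 := by
      rw [← sub_eq_zero, ← norm_eq_zero, ← sq_eq_zero_iff]
      refine le_antisymm ?_ (sq_nonneg _)
      have f1 : inner ℝ (a • p.1) (x - b • q.1 - (x - a • p.1)) ≤ 0 := by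
        rw [inner_smul_left, inner_sub_right, ah]
        exact mul_nonpos_of_nonneg_of_nonpos (by simpa using a0.le) (by linarith)
      have f2 : inner ℝ (b • q.1) (x - a • p.1 - (x - b • q.1)) ≤ 0 := by
        rw [inner_smul_left, inner_sub_right, bh]
        exact mul_nonpos_of_nonneg_of_nonpos (by simpa using b0.le) (by linarith)
      rw [← real_inner_self_eq_norm_sq]
      simp only [inner_sub_left, inner_sub_right] at f1 f2 ⊢
      rw [real_inner_comm x (a • p.1), real_inner_comm x (b • q.1)] at *
      have := real_inner_comm (a • p.1) (b • q.1)
      linarith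
    have hab : a • p.1 = b • q.1 := sub_right_injective hy
    have hab' : a = b := by
      have := congrArg norm hab
      rwa [norm_smul, norm_smul, hs p hp, hs q hq, mul_one, mul_one, Real.norm_of_nonneg a0.le,
        Real.norm_of_nonneg b0.le] at this
    have h1 : p.1 = q.1 := by
      rw [← hab'] at hab
      exact smul_right_injective V a0.ne' hab
    refine Prod.ext h1 ?_
    rw [← ah, ← bh, hy, h1]
  have hdP : Disjoint P (⋃ p ∈ s, prismOver p.1 p.2 ε (halfspaceFace s p)) := by
    refine Set.disjoint_left.2 fun x hx hx' => ?_
    simp only [Set.mem_iUnion] at hx'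
    obtain ⟨p, hp, ⟨h1, -⟩, -⟩ := hx'
    have := hx p hp
    linarith
  have hsub : P ∪ (⋃ p ∈ s, prismOver p.1 p.2 ε (halfspaceFace s p)) ⊆ (1 + ε) • P := by
    have h1ε : 1 + ε ≠ 0 := by positivity
    -- The unit normal is itself a point of the ball. A point of a prism is within `ε` of `P`, so it
    -- exceeds the bound `q.2` by at most `ε ≤ ε * q.2`.
    have hp1 : ∀ p ∈ s, 1 ≤ p.2 := by
      intro p hp
      have := hB (show p.1 ∈ Metric.closedBall 0 1 by simp [hs p hp]) p hp
      rwa [real_inner_self_eq_norm_sq, hs p hp, one_pow] at this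
    rintro x hx
    rw [Set.mem_smul_set_iff_inv_smul_mem₀ h1ε]
    intro q hq
    rw [inner_smul_right, inv_mul_le_iff₀ (by positivity)]
    have hq1 := hp1 q hq
    rcases hx with hx | hx
    · have := hx q hq
      nlinarith
    · simp only [Set.mem_iUnion] at hx
      obtain ⟨p, hp, ⟨h1, h2⟩, h3, -⟩ := hx
      have h4 := h3 q hq
      rw [inner_sub_right, inner_smul_right] at h4
      have h5 : inner ℝ q.1 p.1 ≤ 1 := by
        have := real_inner_le_norm q.1 p.1
        rwa [hs p hp, hs q hq, mul_one] at this
      nlinarith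
  calc volume P + ENNReal.ofReal ε * ∑ p ∈ s, μHE[finrank ℝ V - 1] (halfspaceFace s p)
      = volume P + volume (⋃ p ∈ s, prismOver p.1 p.2 ε (halfspaceFace s p)) := by
        rw [measure_biUnion_finset hdisj fun p _ => hmeas p, Finset.mul_sum]
        congr 1
        refine Finset.sum_congr rfl fun p hp => ?_
        rw [volume_prismOver (hs p hp) _ _ (isClosed_halfspaceFace s p).measurableSet
          fun x hx => hx.2]
    _ = volume (P ∪ (⋃ p ∈ s, prismOver p.1 p.2 ε (halfspaceFace s p))) :=
        (measure_union hdP (Finset.measurableSet_biUnion _ fun p _ => hmeas p)).symm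
    _ ≤ volume ((1 + ε) • P) := measure_mono hsub
    _ = _ := by
        rw [Measure.addHaar_smul, abs_of_nonneg (by positivity)]

/-- Divide by `ε` and let `ε → 0`: the derivative of `x ^ n` at `1` is `n`. -/
theorem le_of_forall_add_mul_le {n : ℕ} {a b : ENNReal} (ha : a ≠ ⊤)
    (h : ∀ ε : ℝ, 0 < ε → a + ENNReal.ofReal ε * b ≤ ENNReal.ofReal ((1 + ε) ^ n) * a) :
    b ≤ n * a := by
  have hb : b ≠ ⊤ := by
    rintro rfl
    have := h 1 one_pos
    simp at this
    exact ENNReal.mul_ne_top (by simp) ha this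
  lift a to NNReal using ha
  lift b to NNReal using hb
  have h' : ∀ ε : ℝ, 0 < ε → (b : ℝ) ≤ (ε⁻¹ * ((1 + ε) ^ n - 1)) * a := by
    intro ε hε
    have h1 := h ε hε
    rw [ENNReal.ofReal, ENNReal.ofReal] at h1
    norm_cast at h1
    have h2 : (a : ℝ) + ε * b ≤ (1 + ε) ^ n * a := by
      have := NNReal.coe_le_coe.2 h1
      simpa [Real.coe_toNNReal _ hε.le, Real.coe_toNNReal ((1 + ε) ^ n) (by positivity),
        max_eq_left hε.le] using this
    rw [mul_assoc, inv_mul_eq_div, le_div_iff₀ hε]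
    linarith
  have hd : HasDerivAt (fun x : ℝ => x ^ n) (n : ℝ) 1 := by simpa using hasDerivAt_pow n (1 : ℝ)
  have hlim := (hd.tendsto_slope_zero_right).mul_const (a : ℝ)
  have : (b : ℝ) ≤ n * a := by
    refine ge_of_tendsto hlim ?_
    filter_upwards [self_mem_nhdsWithin] with ε hε
    simpa using h' ε hε
  exact_mod_cast this

/-- The boundary of a convex body `K` that contains the unit ball has area at most `n * |K|`. -/
theorem euclideanHausdorffMeasure_frontier_le {K : Set V} (hK : IsCompact K) (hc : Convex ℝ K)
    (hB : Metric.closedBall 0 1 ⊆ K) :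
    μHE[finrank ℝ V - 1] (frontier K) ≤ finrank ℝ V * volume K := by
  have h0 : (0 : V) ∈ interior K :=
    mem_interior_iff_mem_nhds.2 (mem_of_superset (Metric.closedBall_mem_nhds _ one_pos) hB)
  have key : ∀ r : ℝ, 1 < r → μHE[finrank ℝ V - 1] (frontier K) ≤
      finrank ℝ V * (ENNReal.ofReal (r ^ finrank ℝ V) * volume K) := by
    intro r hr
    obtain ⟨s, hs, hKs, hsK⟩ := exists_halfspaceInter_between hK hc h0 hr
    have hbdd : Bornology.IsBounded (halfspaceInter s) := (hK.smul r).isBounded.subset hsK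
    have hvol : volume (halfspaceInter s) ≤ ENNReal.ofReal (r ^ finrank ℝ V) * volume K := by
      refine (measure_mono hsK).trans ?_
      rw [Measure.addHaar_smul, abs_of_nonneg (by positivity)]
    calc μHE[finrank ℝ V - 1] (frontier K)
        ≤ μHE[finrank ℝ V - 1] (frontier (halfspaceInter s)) :=
          euclideanHausdorffMeasure_frontier_mono hK hc ⟨0, h0⟩ hbdd hKs _
      _ ≤ ∑ p ∈ s, μHE[finrank ℝ V - 1] (halfspaceFace s p) :=
          (measure_mono (frontier_halfspaceInter_subset s)).trans (measure_biUnion_finset_le _ _)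
      _ ≤ finrank ℝ V * volume (halfspaceInter s) :=
          le_of_forall_add_mul_le hbdd.measure_lt_top.ne
            fun ε hε => volume_add_sum_face_le hs (hB.trans hKs) hε
      _ ≤ _ := by gcongr
  have hlim : Tendsto (fun r : ℝ => (finrank ℝ V : ENNReal) *
      (ENNReal.ofReal (r ^ finrank ℝ V) * volume K)) (𝓝[>] 1) (𝓝 (finrank ℝ V * volume K)) := by
    have h1 : Tendsto (fun r : ℝ => ENNReal.ofReal (r ^ finrank ℝ V)) (𝓝[>] 1) (𝓝 1) := by
      have : Continuous fun r : ℝ => ENNReal.ofReal (r ^ finrank ℝ V) :=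
        ENNReal.continuous_ofReal.comp (by fun_prop)
      simpa using (this.tendsto 1).mono_left nhdsWithin_le_nhds
    have h2 := ENNReal.Tendsto.mul_const (b := volume K) h1 (Or.inl one_ne_zero)
    simp only [one_mul] at h2
    exact ENNReal.Tendsto.const_mul h2 (Or.inr (by simp))
  refine ge_of_tendsto hlim ?_
  filter_upwards [self_mem_nhdsWithin] with r hr
  exact key r hr

end Surface

/-! ### Volume of symmetric intersections of slabs: Brascamp-Lieb by Gaussian transport -/

section VolumeRatio

/-- The monotone transport from the uniform measure on `(-1, 1)` to the Gaussian measure with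
density `exp (-π s ^ 2)`. -/
theorem exists_gaussian_transport : ∃ T : ℝ → ℝ, StrictMonoOn T (Set.Ioo (-1) 1) ∧
    ∀ t ∈ Set.Ioo (-1 : ℝ) 1, HasDerivAt T (2 * Real.exp (-Real.pi * T t ^ 2))⁻¹ t := by
  -- The factor 2 makes the integral over the half-line equal to 1, so the odd primitive `F` is an
  -- increasing bijection of the line onto `(-1, 1)`; `T` is its inverse.
  set g : ℝ → ℝ := fun r => 2 * Real.exp (-Real.pi * r ^ 2) with hg
  have hgc : Continuous g := by fun_prop
  have hgpos : ∀ r, 0 < g r := fun r => by positivity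
  set F : ℝ → ℝ := fun s => ∫ r in (0 : ℝ)..s, g r with hF
  have hFd : ∀ s, HasDerivAt F (g s) s := fun s => (hgc.integral_hasStrictDerivAt 0 s).hasDerivAt
  have hFm : StrictMono F := strictMono_of_deriv_pos fun x => by rw [(hFd x).deriv]; exact hgpos x
  have hFc : Continuous F := continuous_iff_continuousAt.2 fun s => (hFd s).continuousAt
  have hodd : ∀ s, F (-s) = -F s := by
    intro s
    have := intervalIntegral.integral_comp_neg (a := 0) (b := s) g
    simp only [hg, neg_sq, neg_zero] at this
    simp only [hF, hg]
    rw [this, intervalIntegral.integral_symm]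
  have htop : Tendsto F atTop (𝓝 1) := by
    have hint : Integrable g := (integrable_exp_neg_mul_sq Real.pi_pos).const_mul 2
    have := intervalIntegral_tendsto_integral_Ioi 0 hint.integrableOn tendsto_id
    have hval : ∫ x in Set.Ioi 0, g x = 1 := by
      simp only [hg]
      rw [integral_const_mul, integral_gaussian_Ioi, div_self Real.pi_pos.ne', Real.sqrt_one]
      norm_num
    rwa [hval] at this
  have hsurj : ∀ t ∈ Set.Ioo (-1 : ℝ) 1, ∃ s, F s = t := by
    intro t ht
    have h1 : ∃ a, t < F a := (htop.eventually (lt_mem_nhds ht.2)).exists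
    have h2 : ∃ a, -t < F a := (htop.eventually (lt_mem_nhds (by linarith [ht.1]))).exists
    obtain ⟨a, ha⟩ := h1
    obtain ⟨b, hb⟩ := h2
    refine mem_range_of_exists_le_of_exists_ge hFc ⟨-b, ?_⟩ ⟨a, ha.le⟩
    rw [hodd]; linarith
  have hrange : ∀ s, F s ∈ Set.Ioo (-1 : ℝ) 1 := by
    have h1 : ∀ s, F s < 1 := fun s =>
      (hFm (lt_add_one s)).trans_le (hFm.monotone.ge_of_tendsto htop _)
    refine fun s => ⟨?_, h1 s⟩
    have := h1 (-s)
    rw [hodd] at this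
    linarith
  choose! T hT using hsurj
  have hTF : ∀ s, T (F s) = s := fun s => hFm.injective (hT _ (hrange s))
  have hTm : StrictMonoOn T (Set.Ioo (-1) 1) := by
    intro x hx y hy hxy
    rw [← hFm.lt_iff_lt, hT x hx, hT y hy]
    exact hxy
  refine ⟨T, hTm, fun t ht => ?_⟩
  have hnhds : Set.Ioo (-1 : ℝ) 1 ∈ 𝓝 t := isOpen_Ioo.mem_nhds ht
  have himage : T '' Set.Ioo (-1) 1 = Set.univ :=
    Set.eq_univ_of_forall fun s => ⟨F s, hrange s, hTF s⟩
  refine HasDerivAt.of_local_left_inverse (f := F)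
    (hTm.continuousAt_of_image_mem_nhds hnhds (by rw [himage]; exact univ_mem)) (hFd (T t))
    (hgpos _).ne' ?_
  filter_upwards [hnhds] with y hy using hT y hy

variable {V : Type*} [NormedAddCommGroup V] [InnerProductSpace ℝ V] {ι : Type*} [Fintype ι]

/-- The operator `∑ k, a k • u k ⊗ u k`. -/
noncomputable def sumRankOne (u : ι → V) (a : ι → ℝ) : V →L[ℝ] V :=
  ∑ k, a k • (innerSL ℝ (u k)).smulRight (u k)

theorem sumRankOne_apply (u : ι → V) (a : ι → ℝ) (x : V) :
    sumRankOne u a x = ∑ k, (a k * inner ℝ (u k) x) • u k := by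
  simp [sumRankOne, smul_smul]

theorem inner_sumRankOne (u : ι → V) (a : ι → ℝ) (x y : V) :
    inner ℝ x (sumRankOne u a y) = ∑ k, a k * (inner ℝ (u k) x * inner ℝ (u k) y) := by
  rw [sumRankOne_apply, inner_sum]
  refine Finset.sum_congr rfl fun k _ => ?_
  rw [inner_smul_right, real_inner_comm x]
  ring

theorem isSymmetric_sumRankOne (u : ι → V) (a : ι → ℝ) :
    ((sumRankOne u a : V →L[ℝ] V) : V →ₗ[ℝ] V).IsSymmetric := by
  intro x y
  rw [ContinuousLinearMap.coe_coe, real_inner_comm, inner_sumRankOne, inner_sumRankOne]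
  exact Finset.sum_congr rfl fun k _ => by ring

/-- A decomposition of the identity `∑ k, c k • u k ⊗ u k = 1` into unit vectors. -/
structure IsIdentityDecomposition (u : ι → V) (c : ι → ℝ) : Prop where
  norm_eq_one : ∀ k, ‖u k‖ = 1
  nonneg : ∀ k, 0 ≤ c k
  sum_eq : sumRankOne u c = ContinuousLinearMap.id ℝ V

namespace IsIdentityDecomposition

variable {u : ι → V} {c : ι → ℝ}

theorem sum_inner_sq (h : IsIdentityDecomposition u c) (x : V) :
    ∑ k, c k * inner ℝ (u k) x ^ 2 = ‖x‖ ^ 2 := by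
  have := inner_sumRankOne u c x x
  rw [h.sum_eq, ContinuousLinearMap.id_apply, real_inner_self_eq_norm_sq] at this
  rw [this]
  exact Finset.sum_congr rfl fun k _ => by ring

/-- With `y` the vector on the left, expand `0 ≤ ∑ k, c k * (t k - ⟪u k, y⟫) ^ 2`. -/
theorem norm_sq_sum_le (h : IsIdentityDecomposition u c) (t : ι → ℝ) :
    ‖∑ k, (c k * t k) • u k‖ ^ 2 ≤ ∑ k, c k * t k ^ 2 := by
  set y := ∑ k, (c k * t k) • u k with hy
  have h1 : ∑ k, c k * t k * inner ℝ (u k) y = ‖y‖ ^ 2 := by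
    rw [← real_inner_self_eq_norm_sq]
    conv_rhs => rw [hy, sum_inner]
    exact Finset.sum_congr rfl fun k _ => by rw [inner_smul_left]; rfl
  have h2 := h.sum_inner_sq y
  have h3 : 0 ≤ ∑ k, c k * (t k - inner ℝ (u k) y) ^ 2 :=
    Finset.sum_nonneg fun k _ => mul_nonneg (h.nonneg k) (sq_nonneg _)
  have h4 : ∑ k, c k * (t k - inner ℝ (u k) y) ^ 2 = ∑ k, c k * t k ^ 2 -
      2 * ∑ k, c k * t k * inner ℝ (u k) y + ∑ k, c k * inner ℝ (u k) y ^ 2 := by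
    rw [Finset.mul_sum, ← Finset.sum_sub_distrib, ← Finset.sum_add_distrib]
    exact Finset.sum_congr rfl fun k _ => by ring
  linarith

variable [FiniteDimensional ℝ V]

/-- Trace of the decomposition of the identity. -/
theorem sum_eq_finrank (h : IsIdentityDecomposition u c) : ∑ k, c k = finrank ℝ V := by
  set b := stdOrthonormalBasis ℝ V
  have h1 : ∑ j, ∑ k, c k * inner ℝ (u k) (b j) ^ 2 = finrank ℝ V := by
    simp_rw [h.sum_inner_sq]
    simp
  rw [Finset.sum_comm] at h1
  rw [← h1]
  refine Finset.sum_congr rfl fun k _ => ?_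
  have := b.sum_sq_norm_inner_left (u k)
  simp only [Real.norm_eq_abs, sq_abs, h.norm_eq_one k, one_pow] at this
  rw [← Finset.mul_sum, this, mul_one]

/-- In an orthonormal eigenbasis `b`, each eigenvalue is an average of the `t k` with weights `c k *
⟪u k, b j⟫ ^ 2`. These sum to 1 over `k` and to `c k` over `j`, so applying Jensen to the logarithm
and summing over `j` gives the bound. -/
theorem exp_sum_log_le_det (h : IsIdentityDecomposition u c) {t : ι → ℝ} (ht : ∀ k, 0 < t k) :
    Real.exp (∑ k, c k * Real.log (t k)) ≤ (sumRankOne u fun k => c k * t k).det := by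
  set A := sumRankOne u fun k => c k * t k with hA
  have hsymm := isSymmetric_sumRankOne u fun k => c k * t k
  set b := hsymm.eigenvectorBasis rfl
  set μ := hsymm.eigenvalues rfl
  have hw : ∀ j, ∑ k, c k * inner ℝ (u k) (b j) ^ 2 = 1 := fun j => by
    rw [h.sum_inner_sq]; simp
  have hμ : ∀ j, μ j = ∑ k, (c k * inner ℝ (u k) (b j) ^ 2) * t k := by
    intro j
    have h1 : inner ℝ (b j) (A (b j)) = μ j := by
      have : A (b j) = μ j • b j := hsymm.apply_eigenvectorBasis rfl j
      rw [this, inner_smul_right, real_inner_self_eq_norm_sq]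
      simp
    rw [← h1, hA, inner_sumRankOne]
    exact Finset.sum_congr rfl fun k _ => by ring
  have hlog : ∀ j, ∑ k, (c k * inner ℝ (u k) (b j) ^ 2) * Real.log (t k) ≤ Real.log (μ j) := by
    intro j
    rw [hμ]
    exact strictConcaveOn_log_Ioi.concaveOn.le_map_sum
      (fun k _ => mul_nonneg (h.nonneg k) (sq_nonneg _)) (hw j) fun k _ => ht k
  have hpos : ∀ j, 0 < μ j := by
    intro j
    rw [hμ]
    have hnn : ∀ k, 0 ≤ c k * inner ℝ (u k) (b j) ^ 2 := fun k =>
      mul_nonneg (h.nonneg k) (sq_nonneg _)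
    obtain ⟨k, hk⟩ : ∃ k, c k * inner ℝ (u k) (b j) ^ 2 ≠ 0 := by
      by_contra! hcon
      have := hw j
      simp [hcon] at this
    exact Finset.sum_pos' (fun k _ => mul_nonneg (hnn k) (ht k).le)
      ⟨k, Finset.mem_univ _, mul_pos (lt_of_le_of_ne (hnn k) hk.symm) (ht k)⟩
  have hdet : A.det = ∏ j, μ j := hsymm.det_eq_prod_eigenvalues rfl
  rw [hdet, ← Real.exp_log (Finset.prod_pos fun j _ => hpos j),
    Real.log_prod fun j _ => (hpos j).ne']
  refine Real.exp_le_exp.2 ?_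
  calc ∑ k, c k * Real.log (t k)
      = ∑ j, ∑ k, (c k * inner ℝ (u k) (b j) ^ 2) * Real.log (t k) := by
        rw [Finset.sum_comm]
        refine Finset.sum_congr rfl fun k _ => ?_
        have := b.sum_sq_norm_inner_left (u k)
        simp only [Real.norm_eq_abs, sq_abs, h.norm_eq_one k, one_pow] at this
        rw [← Finset.sum_mul, ← Finset.mul_sum, this, mul_one]
    _ ≤ _ := Finset.sum_le_sum fun j _ => hlog j

variable [MeasurableSpace V] [BorelSpace V]

/-- The geometric Brascamp-Lieb inequality for a symmetric intersection of slabs. -/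
theorem volume_slabs_le (h : IsIdentityDecomposition u c) :
    volume {x : V | ∀ k, |inner ℝ (u k) x| < 1} ≤ 2 ^ finrank ℝ V := by
  set S := {x : V | ∀ k, |inner ℝ (u k) x| < 1} with hS
  obtain ⟨T, hTm, hTd⟩ := exists_gaussian_transport
  have hSo : IsOpen S := by
    rw [hS, Set.ofPred_forall]
    exact isOpen_iInter_of_finite fun k => isOpen_lt (by fun_prop) continuous_const
  have hmem : ∀ x ∈ S, ∀ k, inner ℝ (u k) x ∈ Set.Ioo (-1 : ℝ) 1 := fun x hx k => abs_lt.1 (hx k)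
  set T' : ℝ → ℝ := fun t => (2 * Real.exp (-Real.pi * T t ^ 2))⁻¹ with hT'
  have hT'pos : ∀ t, 0 < T' t := fun t => by positivity
  -- The transport map: the one-dimensional transports in the directions `u k`, assembled with the
  -- weights of the decomposition.
  set Θ : V → V := fun x => ∑ k, (c k * T (inner ℝ (u k) x)) • u k with hΘ
  set Θ' : V → V →L[ℝ] V := fun x => sumRankOne u fun k => c k * T' (inner ℝ (u k) x) with hΘ'
  have hderiv : ∀ x ∈ S, HasFDerivWithinAt Θ (Θ' x) S x := by
    intro x hx
    refine HasFDerivAt.hasFDerivWithinAt ?_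
    simp only [hΘ, hΘ', sumRankOne]
    refine HasFDerivAt.fun_sum fun k _ => ?_
    have h1 : HasFDerivAt (fun y : V => inner ℝ (u k) y) (innerSL ℝ (u k)) x :=
      (innerSL ℝ (u k)).hasFDerivAt
    have h2 := ((hTd _ (hmem x hx k)).comp_hasFDerivAt x h1).const_mul (c k)
    refine (h2.smul_const (u k)).congr_fderiv ?_
    ext y
    simp [hT', smul_smul, mul_assoc]
  -- `Θ` is monotone: `⟪Θ x - Θ y, x - y⟫` is a sum of nonnegative terms, and its vanishing forces
  -- `‖x - y‖ ^ 2 = 0` by `sum_inner_sq`.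
  have hinj : Set.InjOn Θ S := by
    intro x hx y hy hxy
    have hterm : ∀ k, 0 ≤ c k * ((T (inner ℝ (u k) x) - T (inner ℝ (u k) y)) *
        (inner ℝ (u k) x - inner ℝ (u k) y)) := by
      intro k
      refine mul_nonneg (h.nonneg k) ?_
      have hx' := hmem x hx k
      have hy' := hmem y hy k
      rcases le_total (inner ℝ (u k) x) (inner ℝ (u k) y) with hle | hle
      · exact mul_nonneg_of_nonpos_of_nonpos (sub_nonpos.2 (hTm.monotoneOn hx' hy' hle))
          (sub_nonpos.2 hle)
      · exact mul_nonneg (sub_nonneg.2 (hTm.monotoneOn hy' hx' hle)) (sub_nonneg.2 hle)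
    have hsum : ∑ k, c k * ((T (inner ℝ (u k) x) - T (inner ℝ (u k) y)) *
        (inner ℝ (u k) x - inner ℝ (u k) y)) = 0 := by
      have h1 : inner ℝ (Θ x - Θ y) (x - y) = 0 := by rw [hxy]; simp
      rw [← h1]
      simp only [hΘ]
      rw [← Finset.sum_sub_distrib, sum_inner]
      refine Finset.sum_congr rfl fun k _ => ?_
      rw [← sub_smul, inner_smul_left, inner_sub_right]
      simp
      ring
    have hzero := (Finset.sum_eq_zero_iff_of_nonneg fun k _ => hterm k).1 hsum
    have hx_y : ∀ k, c k * inner ℝ (u k) (x - y) ^ 2 = 0 := by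
      intro k
      have h1 := hzero k (Finset.mem_univ _)
      rcases mul_eq_zero.1 h1 with h2 | h2
      · rw [h2, zero_mul]
      · have : inner ℝ (u k) x = inner ℝ (u k) y := by
          rcases mul_eq_zero.1 h2 with h3 | h3
          · exact hTm.injOn (hmem x hx k) (hmem y hy k) (sub_eq_zero.1 h3)
          · exact sub_eq_zero.1 h3
        rw [inner_sub_right, this]; simp
    have := h.sum_inner_sq (x - y)
    rw [Finset.sum_eq_zero fun k _ => hx_y k] at this
    rw [← sub_eq_zero, ← norm_eq_zero]
    exact pow_eq_zero_iff two_ne_zero |>.1 this.symm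
  have hpt : ∀ x ∈ S, (1 : ENNReal) ≤ 2 ^ finrank ℝ V * (ENNReal.ofReal |(Θ' x).det| *
      ENNReal.ofReal (Real.exp (-Real.pi * ‖Θ x‖ ^ 2))) := by
    intro x hx
    have h1 := h.exp_sum_log_le_det (t := fun k => T' (inner ℝ (u k) x)) fun k => hT'pos _
    have h2 := h.norm_sq_sum_le fun k => T (inner ℝ (u k) x)
    have h3 : ∑ k, c k * Real.log (T' (inner ℝ (u k) x)) =
        -(finrank ℝ V * Real.log 2) + Real.pi * ∑ k, c k * T (inner ℝ (u k) x) ^ 2 := by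
      rw [← h.sum_eq_finrank, Finset.sum_mul, ← Finset.sum_neg_distrib, Finset.mul_sum,
        ← Finset.sum_add_distrib]
      refine Finset.sum_congr rfl fun k _ => ?_
      simp only [hT']
      rw [Real.log_inv, Real.log_mul two_ne_zero (Real.exp_pos _).ne', Real.log_exp]
      ring
    -- The determinant is at least `∏ T' ^ c k`, in which the factors 2 collect to `2 ^ (-∑ c k)`,
    -- and the exponential `exp (π * ∑ c k * T ^ 2)` dominates `exp (π * ‖Θ x‖ ^ 2)` by
    -- `norm_sq_sum_le`.
    have h4 : (1 : ℝ) ≤ 2 ^ finrank ℝ V * (|(Θ' x).det| * Real.exp (-Real.pi * ‖Θ x‖ ^ 2)) := by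
      calc (1 : ℝ) = 2 ^ finrank ℝ V * (Real.exp (∑ k, c k * Real.log (T' (inner ℝ (u k) x))) *
            Real.exp (-Real.pi * ∑ k, c k * T (inner ℝ (u k) x) ^ 2)) := by
            rw [← Real.exp_add, h3]
            have : (2 : ℝ) ^ finrank ℝ V = Real.exp (finrank ℝ V * Real.log 2) := by
              rw [Real.exp_nat_mul, Real.exp_log two_pos]
            rw [this, ← Real.exp_add, eq_comm, Real.exp_eq_one_iff]
            ring
        _ ≤ _ := by
            refine mul_le_mul_of_nonneg_left ?_ (by positivity)
            refine mul_le_mul (h1.trans (le_abs_self _)) (Real.exp_le_exp.2 ?_) (Real.exp_pos _).le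
              (abs_nonneg _)
            have := mul_le_mul_of_nonneg_left h2 Real.pi_pos.le
            simp only [hΘ]
            linarith
    have h5 := ENNReal.ofReal_le_ofReal h4
    rw [ENNReal.ofReal_mul (by positivity), ENNReal.ofReal_mul (abs_nonneg _),
      ENNReal.ofReal_pow two_pos.le] at h5
    simpa using h5
  have hgauss : ∫⁻ y : V, ENNReal.ofReal (Real.exp (-Real.pi * ‖y‖ ^ 2)) = 1 := by
    have h1 := GaussianFourier.integral_rexp_neg_mul_sq_norm (V := V) Real.pi_pos
    rw [div_self Real.pi_pos.ne', Real.one_rpow] at h1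
    rw [← ofReal_integral_eq_lintegral_ofReal, h1, ENNReal.ofReal_one]
    -- A non-integrable function has Bochner integral 0 by convention, but this integral is 1.
    · by_contra hni
      rw [integral_undef hni] at h1
      exact zero_ne_one h1
    · exact Eventually.of_forall fun y => (Real.exp_pos _).le
  calc volume S = ∫⁻ _ in S, 1 := by simp
    _ ≤ ∫⁻ x in S, 2 ^ finrank ℝ V * (ENNReal.ofReal |(Θ' x).det| *
      ENNReal.ofReal (Real.exp (-Real.pi * ‖Θ x‖ ^ 2))) :=
        setLIntegral_mono' hSo.measurableSet hpt
    _ = 2 ^ finrank ℝ V * ∫⁻ x in S, ENNReal.ofReal |(Θ' x).det| *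
      ENNReal.ofReal (Real.exp (-Real.pi * ‖Θ x‖ ^ 2)) :=
        lintegral_const_mul' _ _ (by simp)
    _ = 2 ^ finrank ℝ V * ∫⁻ y in Θ '' S, ENNReal.ofReal (Real.exp (-Real.pi * ‖y‖ ^ 2)) := by
        rw [lintegral_image_eq_lintegral_abs_det_fderiv_mul volume hSo.measurableSet hderiv hinj]
    _ ≤ 2 ^ finrank ℝ V * ∫⁻ y : V, ENNReal.ofReal (Real.exp (-Real.pi * ‖y‖ ^ 2)) := by
        gcongr
        exact Measure.restrict_le_self
    _ = _ := by rw [hgauss, mul_one]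

/-- Shrinking by `r < 1` moves the closed slabs into the open ones; let `r → 1`. -/
theorem volume_le_of_subset_slabs (h : IsIdentityDecomposition u c) {K : Set V}
    (hK : ∀ x ∈ K, ∀ k, |inner ℝ (u k) x| ≤ 1) : volume K ≤ 2 ^ finrank ℝ V := by
  have key : ∀ r : ℝ, r ∈ Set.Ioo (0 : ℝ) 1 →
      ENNReal.ofReal (r ^ finrank ℝ V) * volume K ≤ 2 ^ finrank ℝ V := by
    intro r hr
    refine le_trans ?_ h.volume_slabs_le
    rw [← abs_of_pos (pow_pos hr.1 _), ← Measure.addHaar_smul]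
    refine measure_mono ?_
    rintro _ ⟨x, hx, rfl⟩ k
    simp only [inner_smul_right, abs_mul, abs_of_pos hr.1]
    nlinarith [hK x hx k, hr.1, hr.2]
  have h1 : Tendsto (fun r : ℝ => ENNReal.ofReal (r ^ finrank ℝ V)) (𝓝[<] 1) (𝓝 1) := by
    have : Continuous fun r : ℝ => ENNReal.ofReal (r ^ finrank ℝ V) :=
      ENNReal.continuous_ofReal.comp (by fun_prop)
    simpa using (this.tendsto 1).mono_left nhdsWithin_le_nhds
  have h2 := ENNReal.Tendsto.mul_const (b := volume K) h1 (Or.inl one_ne_zero)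
  rw [one_mul] at h2
  refine le_of_tendsto h2 ?_
  filter_upwards [Ioo_mem_nhdsLT zero_lt_one] with r hr
  exact key r hr

end IsIdentityDecomposition

end VolumeRatio

/-! ### John position: existence, and John's decomposition of the identity -/

section John

/-- By Carathéodory, `finrank + 1` points suffice, so the hull is a continuous image of simplex × `s
^ d`. Shorter combinations are padded with weight 0 at `z₀`. -/
theorem IsCompact.isCompact_convexHull {F : Type*} [NormedAddCommGroup F] [NormedSpace ℝ F]
    [FiniteDimensional ℝ F] {s : Set F} (hs : IsCompact s) : IsCompact (convexHull ℝ s) := by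
  rcases s.eq_empty_or_nonempty with rfl | ⟨z₀, hz₀⟩
  · simp
  set d := finrank ℝ F + 1
  set g : (Fin d → ℝ) × (Fin d → F) → F := fun q => ∑ i, q.1 i • q.2 i
  have hg : Continuous g := by fun_prop
  have hcomp : IsCompact (stdSimplex ℝ (Fin d) ×ˢ Set.univ.pi fun _ : Fin d => s) :=
    (isCompact_stdSimplex ℝ (Fin d)).prod (isCompact_univ_pi fun _ => hs)
  convert hcomp.image hg using 1
  refine Set.Subset.antisymm ?_ ?_
  · intro x hx
    obtain ⟨ι, hι, z, w, hz, haff, hw, hw1, rfl⟩ := eq_pos_convex_span_of_mem_convexHull hx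
    have hcard : Fintype.card ι ≤ Fintype.card (Fin d) := by
      have h1 := haff.card_le_finrank_succ
      have h2 := Submodule.finrank_le (vectorSpan ℝ (Set.range z))
      rw [Fintype.card_fin]
      lia
    obtain ⟨e⟩ := Function.Embedding.nonempty_of_card_le hcard
    have hout : ∀ j, j ∉ Set.range e → Function.extend e w 0 j = 0 := fun j hj => by
      rw [Function.extend_apply' _ _ _ (by simpa using hj)]; rfl
    refine ⟨(Function.extend e w 0, Function.extend e z fun _ => z₀), ⟨⟨?_, ?_⟩, ?_⟩, ?_⟩
    · intro j
      by_cases hj : j ∈ Set.range e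
      · obtain ⟨i, rfl⟩ := hj
        simpa [e.injective.extend_apply] using (hw i).le
      · exact (hout j hj).ge
    · rw [← hw1]
      exact (Fintype.sum_of_injective e e.injective _ _ hout
        fun i => by rw [e.injective.extend_apply]).symm
    · intro j _
      by_cases hj : j ∈ Set.range e
      · obtain ⟨i, rfl⟩ := hj
        simpa [e.injective.extend_apply] using hz ⟨i, rfl⟩
      · have : Function.extend e z (fun _ => z₀) j = z₀ :=
          Function.extend_apply' _ _ _ (by simpa using hj)
        simpa only [this] using hz₀
    · exact (Fintype.sum_of_injective e e.injective _ _
        (fun j hj => by simp only [hout j hj, zero_smul])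
        fun i => by simp only [e.injective.extend_apply]).symm
  · rintro _ ⟨⟨w, z⟩, ⟨hw, hz⟩, rfl⟩
    exact (convex_convexHull ℝ s).sum_mem (fun i _ => hw.1 i) hw.2
      fun i _ => subset_convexHull ℝ s (hz i (Set.mem_univ i))

variable {n : ℕ}

local notation "𝔼" n => EuclideanSpace ℝ (Fin n)

theorem AffineEquiv.apply_eq_linear_add {V : Type*} [AddCommGroup V] [Module ℝ V]
    (ψ : V ≃ᵃ[ℝ] V) (x : V) : ψ x = ψ.linear x + ψ 0 := by
  simpa using ψ.map_vadd 0 x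

theorem volume_affineEquiv_image {V : Type*} [NormedAddCommGroup V] [InnerProductSpace ℝ V]
    [FiniteDimensional ℝ V] [MeasurableSpace V] [BorelSpace V] (ψ : V ≃ᵃ[ℝ] V) (S : Set V) :
    volume (ψ '' S) =
      ENNReal.ofReal |LinearMap.det (ψ.linear : V →ₗ[ℝ] V)| * volume S := by
  have : ψ '' S = (fun y => y + ψ 0) '' ((ψ.linear : V →ₗ[ℝ] V) '' S) := by
    rw [Set.image_image]
    exact Set.image_congr fun x _ => ψ.apply_eq_linear_add x
  rw [this, Set.image_add_right, measure_preimage_add_right, Measure.addHaar_image_linearMap]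

theorem exists_affineEquiv_eq {V : Type*} [NormedAddCommGroup V] [NormedSpace ℝ V]
    [FiniteDimensional ℝ V] {A : V →ₗ[ℝ] V} (hA : LinearMap.det A ≠ 0) (b : V) :
    ∃ ψ : V ≃ᵃ[ℝ] V, (ψ.linear : V →ₗ[ℝ] V) = A ∧ ∀ x, ψ x = A x + b := by
  refine ⟨(LinearMap.equivOfDetNeZero A hA).toAffineEquiv.trans (AffineEquiv.constVAdd ℝ V b),
    ?_, ?_⟩
  · rfl
  · intro x
    simp [LinearMap.equivOfDetNeZero, add_comm]

/-- Every body with interior points has an affine image in John position. -/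
theorem exists_inJohnPosition {K : Set (𝔼 n)} (hK : IsCompact K) (hne : (interior K).Nonempty) :
    ∃ φ : (𝔼 n) ≃ᵃ[ℝ] (𝔼 n), InJohnPosition (φ '' K) := by
  -- Affine maps sending the ball into `K`, singular ones included so that the set is closed; a
  -- small ball inside `K` shows that the maximal |det| is nonzero.
  set 𝒜 : Set (((𝔼 n) →L[ℝ] (𝔼 n)) × (𝔼 n)) :=
    {q | ∀ x ∈ Metric.closedBall (0 : 𝔼 n) 1, q.1 x + q.2 ∈ K} with h𝒜
  have hclosed : IsClosed 𝒜 := by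
    have : 𝒜 = ⋂ x ∈ Metric.closedBall (0 : 𝔼 n) 1,
        (fun q : ((𝔼 n) →L[ℝ] (𝔼 n)) × (𝔼 n) => q.1 x + q.2) ⁻¹' K := by
      ext; simp [h𝒜]
    rw [this]
    exact isClosed_biInter fun x _ => hK.isClosed.preimage (by fun_prop)
  obtain ⟨R, hR⟩ := hK.isBounded.subset_closedBall 0
  have hR' : ∀ y ∈ K, ‖y‖ ≤ R := fun y hy => by simpa using hR hy
  have hbdd : Bornology.IsBounded 𝒜 := by
    refine (Metric.isBounded_closedBall (x := (0 : ((𝔼 n) →L[ℝ] (𝔼 n)) × (𝔼 n)))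
      (r := 2 * R)).subset fun q hq => ?_
    have hb : ‖q.2‖ ≤ R := by simpa using hR' _ (hq 0 (by simp))
    have hR0 : 0 ≤ R := (norm_nonneg _).trans hb
    rw [mem_closedBall_zero_iff, Prod.norm_def]
    refine max_le ?_ (by linarith)
    refine ContinuousLinearMap.opNorm_le_of_unit_norm (by linarith) fun x hx => ?_
    have h1 := hR' _ (hq x (by simp [hx]))
    have h2 : ‖q.1 x‖ ≤ ‖q.1 x + q.2‖ + ‖q.2‖ := by
      simpa using norm_sub_le (q.1 x + q.2) q.2
    linarith
  have hcomp : IsCompact 𝒜 := Metric.isCompact_of_isClosed_isBounded hclosed hbdd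
  obtain ⟨b₀, hb₀⟩ := hne
  obtain ⟨ρ, hρ, hball⟩ := Metric.isOpen_iff.1 isOpen_interior _ hb₀
  have hmem₀ : ((ρ / 2) • ContinuousLinearMap.id ℝ (𝔼 n), b₀) ∈ 𝒜 := by
    intro x hx
    rw [mem_closedBall_zero_iff] at hx
    refine interior_subset (hball ?_)
    simp [norm_smul, abs_of_pos hρ]
    nlinarith
  have hcont : Continuous fun q : ((𝔼 n) →L[ℝ] (𝔼 n)) × (𝔼 n) => |q.1.det| :=
    (ContinuousLinearMap.continuous_det.comp continuous_fst).abs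
  obtain ⟨q, hq, hmax⟩ := hcomp.exists_isMaxOn ⟨_, hmem₀⟩ hcont.continuousOn
  have hdet : LinearMap.det (q.1 : (𝔼 n) →ₗ[ℝ] (𝔼 n)) ≠ 0 := by
    have h1 := hmax hmem₀
    simp only [Set.mem_ofPred_eq, ContinuousLinearMap.det] at h1
    intro h0
    rw [h0, abs_zero] at h1
    have : LinearMap.det ((ρ / 2) • LinearMap.id : (𝔼 n) →ₗ[ℝ] (𝔼 n)) ≠ 0 := by
      rw [LinearMap.det_smul]
      simp [hρ.ne']
    exact this (abs_nonpos_iff.1 h1)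
  obtain ⟨ψ₀, hlin, hψ₀⟩ := exists_affineEquiv_eq hdet q.2
  refine ⟨ψ₀.symm, ?_, ?_⟩
  · intro x hx
    refine ⟨ψ₀ x, ?_, by simp⟩
    rw [hψ₀]
    exact hq x hx
  · rintro _ ⟨ψ, rfl⟩ hsub
    have hmem : (LinearMap.toContinuousLinearMap ((ψ.trans ψ₀).linear : (𝔼 n) →ₗ[ℝ] (𝔼 n)),
        (ψ.trans ψ₀) 0) ∈ 𝒜 := by
      intro x hx
      obtain ⟨y, hy, hxy⟩ := hsub ⟨x, hx, rfl⟩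
      have h1 := (ψ.trans ψ₀).apply_eq_linear_add x
      simp only [LinearMap.coe_toContinuousLinearMap', LinearEquiv.coe_coe]
      rw [← h1, AffineEquiv.trans_apply, ← hxy, AffineEquiv.apply_symm_apply]
      exact hy
    have h1 := hmax hmem
    simp only [Set.mem_ofPred_eq, ContinuousLinearMap.det,
      LinearMap.coe_toContinuousLinearMap] at h1
    have h2 : ((ψ.trans ψ₀).linear : (𝔼 n) →ₗ[ℝ] (𝔼 n)) =
        (ψ₀.linear : (𝔼 n) →ₗ[ℝ] (𝔼 n)) ∘ₗ (ψ.linear : (𝔼 n) →ₗ[ℝ] (𝔼 n)) := rfl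
    rw [h2, LinearMap.det_comp, abs_mul, hlin] at h1
    have h3 : |LinearMap.det (ψ.linear : (𝔼 n) →ₗ[ℝ] (𝔼 n))| ≤ 1 :=
      le_of_mul_le_mul_left (by simpa using h1) (abs_pos.2 hdet)
    rw [volume_affineEquiv_image]
    calc _ ≤ ENNReal.ofReal 1 * volume (Metric.closedBall (0 : 𝔼 n) 1) := by gcongr
      _ = _ := by simp

/-- The unit normals of the common supporting hyperplanes of `K` and the unit ball (if `K`
contains the unit ball). -/
def contactNormals (K : Set (𝔼 n)) : Set (𝔼 n) :=
  {u | ‖u‖ = 1 ∧ ∀ x ∈ K, inner ℝ u x ≤ 1}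

theorem isCompact_contactNormals (K : Set (𝔼 n)) : IsCompact (contactNormals K) := by
  refine (isCompact_sphere (0 : 𝔼 n) 1).of_isClosed_subset ?_ fun u hu => by simpa using hu.1
  have : contactNormals K = {u | ‖u‖ = 1} ∩ ⋂ x ∈ K, {u | inner ℝ u x ≤ 1} := by
    ext; simp [contactNormals]
  rw [this]
  exact (isClosed_eq continuous_norm continuous_const).inter
    (isClosed_biInter fun x _ => isClosed_le (by fun_prop) continuous_const)

/-- The trace is the first order term of `det (1 + r • H)`. -/
theorem Matrix.eventually_one_lt_det_one_add_smul {m : Type*} [Fintype m] [DecidableEq m]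
    {H : Matrix m m ℝ} (hH : 0 < H.trace) : ∀ᶠ r : ℝ in 𝓝[>] 0, 1 < (1 + r • H).det := by
  set q := (Matrix.det (1 + (Polynomial.X : Polynomial ℝ) • H.map Polynomial.C)).divX.divX
  have hlim : Tendsto (fun r : ℝ => H.trace + q.eval r * r) (𝓝[>] 0) (𝓝 H.trace) := by
    have : Continuous fun r : ℝ => H.trace + q.eval r * r := by fun_prop
    simpa using (this.tendsto 0).mono_left nhdsWithin_le_nhds
  filter_upwards [hlim.eventually (lt_mem_nhds hH), self_mem_nhdsWithin] with r h1 h2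
  rw [Matrix.det_one_add_smul]
  have : 0 < (H.trace + q.eval r * r) * r := mul_pos h1 h2
  change 1 < 1 + H.trace * r + q.eval r * r ^ 2
  linarith

theorem exists_unit_separating {V : Type*} [NormedAddCommGroup V] [InnerProductSpace ℝ V]
    [CompleteSpace V] {K : Set V} (hK : IsClosed K) (hc : Convex ℝ K) (hne : K.Nonempty) {y : V}
    (hy : y ∉ K) : ∃ v : V, ‖v‖ = 1 ∧ ∀ x ∈ K, inner ℝ v x < inner ℝ v y := by
  obtain ⟨f, a, hf, hfy⟩ := geometric_hahn_banach_closed_point hc hK hy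
  set u := (InnerProductSpace.toDual ℝ V).symm f
  have hu : ∀ x, inner ℝ u x = f x := fun x => InnerProductSpace.toDual_symm_apply
  have hu0 : u ≠ 0 := by
    intro h0
    obtain ⟨x, hx⟩ := hne
    have := (hf x hx).trans hfy
    rw [← hu, ← hu, h0] at this
    simp at this
  refine ⟨‖u‖⁻¹ • u, by simp [norm_smul, hu0], fun x hx => ?_⟩
  rw [inner_smul_left, inner_smul_left, hu, hu]
  exact mul_lt_mul_of_pos_left ((hf x hx).trans hfy) (by simpa using hu0)

/-- First order optimality of the unit ball among the ellipsoids in `K`. -/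
theorem InJohnPosition.trace_nonpos {K : Set (𝔼 n)} (hJ : InJohnPosition K) (hK : IsClosed K)
    (hc : Convex ℝ K) {H : Matrix (Fin n) (Fin n) ℝ}
    (hH : ∀ u ∈ contactNormals K, inner ℝ u (Matrix.toEuclideanCLM (𝕜 := ℝ) H u) < 0) :
    H.trace ≤ 0 := by
  by_contra! htr
  obtain ⟨hB, hmax⟩ := hJ
  set A : (𝔼 n) →L[ℝ] (𝔼 n) := Matrix.toEuclideanCLM (𝕜 := ℝ) H with hA
  have hdetA : ∀ r : ℝ, LinearMap.det
      (((1 : (𝔼 n) →L[ℝ] (𝔼 n)) + r • A : (𝔼 n) →L[ℝ] (𝔼 n)) : (𝔼 n) →ₗ[ℝ] (𝔼 n)) =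
      (1 + r • H).det := by
    intro r
    have : (1 : (𝔼 n) →L[ℝ] (𝔼 n)) + r • A = Matrix.toEuclideanCLM (𝕜 := ℝ) (1 + r • H) := by
      simp [hA]
    rw [this, Matrix.coe_toEuclideanCLM_eq_toEuclideanLin, Matrix.toEuclideanLin_eq_toLin_orthonormal,
      LinearMap.det_toLin]
  set B := ContinuousLinearMap.adjoint A with hBdef
  -- The image of the ball under `1 + r • A` has larger volume than the ball, so some point of it
  -- can be separated from `K`. In direction `v` that image has support value `‖v + r • B v‖`.
  have hfail : ∀ᶠ r : ℝ in 𝓝[>] 0, ∃ v : 𝔼 n, ‖v‖ = 1 ∧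
      ∀ y ∈ K, inner ℝ v y ≤ ‖v + r • B v‖ := by
    filter_upwards [Matrix.eventually_one_lt_det_one_add_smul htr] with r hr
    rw [← hdetA] at hr
    obtain ⟨ψ, hlin, hψ⟩ := exists_affineEquiv_eq (by positivity) (0 : 𝔼 n)
    have hnot : ¬ ψ '' Metric.closedBall 0 1 ⊆ K := by
      intro hsub
      have h1 := hmax _ ⟨ψ, rfl⟩ hsub
      rw [volume_affineEquiv_image, hlin, abs_of_pos (by positivity)] at h1
      have hpos : 0 < volume (Metric.closedBall (0 : 𝔼 n) 1) :=
        (Metric.measure_ball_pos volume 0 one_pos).trans_le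
          (measure_mono Metric.ball_subset_closedBall)
      have hfin : volume (Metric.closedBall (0 : 𝔼 n) 1) ≠ ⊤ := measure_closedBall_lt_top.ne
      have h2 : ENNReal.ofReal 1 * volume (Metric.closedBall (0 : 𝔼 n) 1) <
          ENNReal.ofReal (LinearMap.det (((1 : (𝔼 n) →L[ℝ] (𝔼 n)) + r • A :
            (𝔼 n) →L[ℝ] (𝔼 n)) : (𝔼 n) →ₗ[ℝ] (𝔼 n))) * volume (Metric.closedBall (0 : 𝔼 n) 1) := by
        refine ENNReal.mul_lt_mul_left hpos.ne' hfin ?_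
        exact (ENNReal.ofReal_lt_ofReal_iff (by linarith)).2 hr
      rw [ENNReal.ofReal_one, one_mul] at h2
      exact absurd h1 (not_le.2 h2)
    obtain ⟨_, ⟨x, hx, rfl⟩, hxK⟩ := Set.not_subset.1 hnot
    obtain ⟨v, hv, hsep⟩ := exists_unit_separating hK hc ⟨0, hB (by simp)⟩ hxK
    refine ⟨v, hv, fun y hy => (hsep y hy).le.trans ?_⟩
    have h1 : inner ℝ v (ψ x) = inner ℝ (v + r • B v) x := by
      rw [hψ, inner_add_left, inner_smul_left, ContinuousLinearMap.adjoint_inner_left]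
      simp [inner_add_right, inner_smul_right]
    rw [h1]
    refine (real_inner_le_norm _ _).trans ?_
    exact mul_le_of_le_one_right (norm_nonneg _) (by simpa using hx)
  have hδ : Tendsto (fun k : ℕ => 1 / ((k : ℝ) + 1)) atTop (𝓝[>] 0) :=
    tendsto_nhdsWithin_iff.2 ⟨tendsto_one_div_add_atTop_nhds_zero_nat,
      Eventually.of_forall fun k => by simp; positivity⟩
  obtain ⟨N, hN⟩ := eventually_atTop.1 (hδ.eventually hfail)
  choose v hv hvK using fun k : ℕ => hN (k + N) (Nat.le_add_left _ _)
  set δ : ℕ → ℝ := fun k => 1 / (((k + N : ℕ) : ℝ) + 1) with hδdef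
  have hδ0 : Tendsto δ atTop (𝓝 0) :=
    (tendsto_nhdsWithin_iff.1 hδ).1.comp (tendsto_add_atTop_nat N)
  have hδpos : ∀ k, 0 < δ k := fun k => by positivity
  -- As `r → 0` the separating directions accumulate at a contact normal `w` with `⟪w, A w⟫ ≥ 0`,
  -- contrary to `hH`.
  obtain ⟨w, hw, σ, hσ, hlim⟩ := (isCompact_sphere (0 : 𝔼 n) 1).tendsto_subseq
    (x := v) fun k => by simp [hv k]
  have hδσ : Tendsto (δ ∘ σ) atTop (𝓝 0) := hδ0.comp hσ.tendsto_atTop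
  have hw1 : ‖w‖ = 1 := by simpa using hw
  have hlimB : Tendsto (fun k => B (v (σ k))) atTop (𝓝 (B w)) := (B.continuous.tendsto w).comp hlim
  have hcontact : w ∈ contactNormals K := by
    refine ⟨hw1, fun y hy => ?_⟩
    have h1 : Tendsto (fun k => inner ℝ (v (σ k)) y) atTop (𝓝 (inner ℝ w y)) :=
      hlim.inner tendsto_const_nhds
    have h2 : Tendsto (fun k => ‖v (σ k) + δ (σ k) • B (v (σ k))‖) atTop (𝓝 ‖w + (0 : ℝ) • B w‖) :=
      (hlim.add (hδσ.smul hlimB)).norm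
    rw [zero_smul, add_zero, hw1] at h2
    exact le_of_tendsto_of_tendsto' h1 h2 fun k => hvK (σ k) y hy
  have hquad : 0 ≤ inner ℝ w (A w) := by
    have h1 : ∀ k, 0 ≤ 2 * inner ℝ (v (σ k)) (B (v (σ k))) +
        δ (σ k) * ‖B (v (σ k))‖ ^ 2 := by
      intro k
      -- Test the separation at `v` itself, a point of the ball, then square and divide by `δ`.
      have h2 := hvK (σ k) (v (σ k)) (hB (by simp [hv]))
      rw [real_inner_self_eq_norm_sq, hv, one_pow] at h2
      have h3 : 1 ≤ ‖v (σ k) + δ (σ k) • B (v (σ k))‖ ^ 2 := by nlinarith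
      rw [norm_add_sq_real, hv, inner_smul_right, norm_smul, mul_pow, Real.norm_eq_abs, sq_abs] at h3
      have h4 : 0 ≤ δ (σ k) * (2 * inner ℝ (v (σ k)) (B (v (σ k))) +
        δ (σ k) * ‖B (v (σ k))‖ ^ 2) := by linarith
      exact nonneg_of_mul_nonneg_right h4 (hδpos _)
    have h2 : Tendsto (fun k => 2 * inner ℝ (v (σ k)) (B (v (σ k))) +
        δ (σ k) * ‖B (v (σ k))‖ ^ 2) atTop (𝓝 (2 * inner ℝ w (B w) + 0 * ‖B w‖ ^ 2)) :=
      ((hlim.inner hlimB).const_mul 2).add (hδσ.mul (hlimB.norm.pow 2))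
    have h3 := ge_of_tendsto' h2 h1
    rw [ContinuousLinearMap.adjoint_inner_right, real_inner_comm] at h3
    linarith
  exact absurd (hH w hcontact) (not_lt.2 hquad)

/-- John's theorem for symmetric bodies. -/
theorem InJohnPosition.exists_isIdentityDecomposition {K : Set (𝔼 n)} (hn : n ≠ 0)
    (hJ : InJohnPosition K) (hK : IsClosed K) (hc : Convex ℝ K) (hsymm : ∀ x ∈ K, -x ∈ K) :
    ∃ (ι : Type) (_ : Fintype ι) (u : ι → 𝔼 n) (c : ι → ℝ), IsIdentityDecomposition u c ∧
      ∀ x ∈ K, ∀ k, |inner ℝ (u k) x| ≤ 1 := by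
  set M : (𝔼 n) → Fin n → Fin n → ℝ := fun u i j => u i * u j with hM
  have hMc : Continuous M := by fun_prop
  have hn' : (n : ℝ) ≠ 0 := Nat.cast_ne_zero.2 hn
  set p : Fin n → Fin n → ℝ := fun i j => if i = j then (n : ℝ)⁻¹ else 0 with hp
  -- Otherwise a functional `f` and a level `a` separate 1/n times the identity from all u ⊗ u. Then
  -- `H`, which is `a` times the identity minus the matrix of `f`, is negative on contact normals
  -- but has trace `n * (a - f p) > 0`, contradicting `trace_nonpos`.
  have hhull : p ∈ convexHull ℝ (M '' contactNormals K) := by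
    by_contra hnot
    obtain ⟨f, a, hfp, hf⟩ := geometric_hahn_banach_point_closed (convex_convexHull ℝ _)
      ((isCompact_contactNormals K).image hMc).isCompact_convexHull.isClosed hnot
    set H : Matrix (Fin n) (Fin n) ℝ := Matrix.of fun i j =>
      (if i = j then a else 0) - f (Pi.single i (Pi.single j 1)) with hH
    have hfX : ∀ X : Fin n → Fin n → ℝ, f X = ∑ i, ∑ j, X i j * f (Pi.single i (Pi.single j 1)) := by
      intro X
      have hX : X = ∑ i, ∑ j, X i j • (Pi.single i (Pi.single j 1) : Fin n → Fin n → ℝ) := by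
        ext i j
        simp [Finset.sum_apply, Pi.single_apply, apply_ite, ite_apply]
      conv_lhs => rw [hX]
      simp [map_sum]
    have htr : H.trace ≤ 0 := by
      refine hJ.trace_nonpos hK hc fun u hu => ?_
      have h1 := hf (M u) (subset_convexHull ℝ _ ⟨u, hu, rfl⟩)
      have h2 : inner ℝ u (Matrix.toEuclideanCLM (𝕜 := ℝ) H u) = ∑ i, ∑ j, H i j * (u i * u j) := by
        rw [PiLp.inner_apply]
        refine Finset.sum_congr rfl fun i _ => ?_
        rw [Matrix.ofLp_toEuclideanCLM]
        simp only [Matrix.mulVec, dotProduct, RCLike.inner_apply, conj_trivial]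
        rw [Finset.sum_mul]
        exact Finset.sum_congr rfl fun j _ => by ring
      have h3 : ∑ i, ∑ j, H i j * (u i * u j) = a * ‖u‖ ^ 2 - f (M u) := by
        rw [hfX, EuclideanSpace.real_norm_sq_eq, Finset.mul_sum, ← Finset.sum_sub_distrib]
        refine Finset.sum_congr rfl fun i _ => ?_
        simp only [hH, Matrix.of_apply, sub_mul, Finset.sum_sub_distrib, ite_mul, zero_mul,
          Finset.sum_ite_eq, Finset.mem_univ, if_true]
        congr 1
        · ring
        · exact Finset.sum_congr rfl fun j _ => by rw [mul_comm]
      rw [h2, h3, hu.1]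
      linarith
    have htr' : H.trace = n * (a - f p) := by
      have h1 : f p = (n : ℝ)⁻¹ * ∑ i : Fin n, f (Pi.single i (Pi.single i 1)) := by
        rw [hfX, Finset.mul_sum]
        refine Finset.sum_congr rfl fun i _ => ?_
        simp [hp, ite_mul]
      rw [h1, mul_sub, ← mul_assoc, mul_inv_cancel₀ hn', one_mul]
      simp [Matrix.trace, hH, Finset.sum_sub_distrib]
    rw [htr'] at htr
    have : 0 < (n : ℝ) * (a - f p) := mul_pos (by positivity) (by linarith)
    linarith
  obtain ⟨ι, hι, w, z, hw, hw1, hz, hsum⟩ := mem_convexHull_iff_exists_fintype.1 hhull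
  choose u hu hMu using hz
  refine ⟨ι, hι, u, fun k => n * w k, ⟨fun k => (hu k).1, fun k => by have := hw k; positivity, ?_⟩, ?_⟩
  · ext x i
    rw [sumRankOne_apply]
    have hij : ∀ i j, ∑ k, w k * (u k i * u k j) = if i = j then (n : ℝ)⁻¹ else 0 := by
      intro i j
      have := congrFun (congrFun hsum i) j
      simp only [← hMu, hM, hp, Finset.sum_apply, Pi.smul_apply, smul_eq_mul] at this
      exact this
    simp only [WithLp.ofLp_sum, WithLp.ofLp_smul, Finset.sum_apply, Pi.smul_apply, smul_eq_mul,
      ContinuousLinearMap.id_apply, PiLp.inner_apply, RCLike.inner_apply, conj_trivial]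
    calc ∑ k, (n * w k * ∑ j, x j * u k j) * u k i
        = ∑ j, n * (∑ k, w k * (u k i * u k j)) * x j := by
          simp_rw [Finset.mul_sum, Finset.sum_mul]
          rw [Finset.sum_comm]
          exact Finset.sum_congr rfl fun j _ => Finset.sum_congr rfl fun k _ => by ring
      _ = x i := by
          simp [hij, hn']
  · intro x hx k
    rw [abs_le]
    have h1 := (hu k).2 _ (hsymm x hx)
    rw [inner_neg_right] at h1
    exact ⟨by linarith, (hu k).2 x hx⟩

end John

/-! ### Volume of a cube, and a lower bound for its surface area -/

section Cube

variable {n : ℕ}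

theorem surfaceArea_affineIsometryEquiv_image
    (g : EuclideanSpace ℝ (Fin n) ≃ᵃⁱ[ℝ] EuclideanSpace ℝ (Fin n))
    (S : Set (EuclideanSpace ℝ (Fin n))) : surfaceArea (g '' S) = surfaceArea S := by
  have h : frontier (g '' S) = g '' frontier S := (g.toHomeomorph.image_frontier S).symm
  rw [surfaceArea, surfaceArea, h, g.isometry.euclideanHausdorffMeasure_image]

theorem volume_affineIsometryEquiv_image
    (g : EuclideanSpace ℝ (Fin n) ≃ᵃⁱ[ℝ] EuclideanSpace ℝ (Fin n))
    (S : Set (EuclideanSpace ℝ (Fin n))) : volume (g '' S) = volume S := by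
  rw [← EuclideanSpace.euclideanHausdorffMeasure_eq_volume,
    g.isometry.euclideanHausdorffMeasure_image]

theorem surfaceArea_smul {r : ℝ} (hr : 0 < r) (S : Set (EuclideanSpace ℝ (Fin n))) :
    surfaceArea (r • S) = ENNReal.ofReal (r ^ (n - 1)) * surfaceArea S := by
  have h : frontier (r • S) = r • frontier S :=
    ((Homeomorph.smulOfNeZero r hr.ne').image_frontier S).symm
  rw [surfaceArea, surfaceArea, h, Measure.euclideanHausdorffMeasure_smul₀ _ hr.ne',
    ENNReal.smul_def, smul_eq_mul, ENNReal.ofReal_pow hr.le, ENNReal.coe_pow,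
    ← enorm_eq_nnnorm, Real.enorm_of_nonneg hr.le]

theorem volume_cube {s : ℝ} (hs : 0 ≤ s) :
    volume {x : EuclideanSpace ℝ (Fin n) | ∀ i, x i ∈ Set.Icc 0 s} = ENNReal.ofReal (s ^ n) := by
  have h1 : {x : EuclideanSpace ℝ (Fin n) | ∀ i, x i ∈ Set.Icc 0 s} =
      (WithLp.ofLp) ⁻¹' (Set.univ.pi fun _ : Fin n => Set.Icc 0 s) := by
    ext x; simp only [Set.mem_preimage, Set.mem_univ_pi, Set.mem_ofPred_eq]
  rw [h1, (PiLp.volume_preserving_ofLp (Fin n)).measure_preimage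
    (MeasurableSet.univ_pi fun _ => measurableSet_Icc).nullMeasurableSet, volume_pi_pi]
  simp [ENNReal.ofReal_pow hs]

/-- The relatively open facet `x i = b` of the cube `[0, s]ⁿ`. -/
def openFacet (s : ℝ) (i : Fin n) (b : ℝ) : Set (EuclideanSpace ℝ (Fin n)) :=
  {x | x i = b ∧ ∀ j, j ≠ i → x j ∈ Set.Ioo 0 s}

theorem measurableSet_openFacet (s : ℝ) (i : Fin n) (b : ℝ) :
    MeasurableSet (openFacet s i b) := by
  have : openFacet s i b = {x | x i = b} ∩ ⋂ j, {x | j ≠ i → x j ∈ Set.Ioo 0 s} := by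
    ext; simp [openFacet]
  rw [this]
  refine (isClosed_eq (by fun_prop) continuous_const).measurableSet.inter
    (MeasurableSet.iInter fun j => ?_)
  by_cases hj : j = i
  · simp [hj]
  · simp only [ne_eq, hj, not_false_eq_true, true_imp_iff]
    exact (isOpen_Ioo.preimage
      (f := fun x : EuclideanSpace ℝ (Fin n) => x j) (by fun_prop)).measurableSet

/-- The prism of height `s` over the facet is an open cube of volume `s ^ n`; divide by `s`. -/
theorem euclideanHausdorffMeasure_openFacet {s : ℝ} (hs : 0 < s) (i : Fin n) (b : ℝ) :
    μHE[n - 1] (openFacet s i b) = ENNReal.ofReal (s ^ (n - 1)) := by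
  have h1 := volume_prismOver (ν := EuclideanSpace.single i (1 : ℝ)) (by simp) b s
    (measurableSet_openFacet s i b) (fun x hx => by simpa [EuclideanSpace.inner_single_left] using hx.1)
  have h2 : prismOver (EuclideanSpace.single i (1 : ℝ)) b s (openFacet s i b) =
      (WithLp.ofLp) ⁻¹' (Set.univ.pi fun j : Fin n =>
        if j = i then Set.Ioo b (b + s) else Set.Ioo 0 s) := by
    ext x
    simp only [prismOver, openFacet, EuclideanSpace.inner_single_left, Set.mem_ofPred_eq,
      Set.mem_preimage, Set.mem_pi, Set.mem_univ, true_imp_iff, map_one, one_mul]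
    constructor
    · rintro ⟨⟨ha, hb⟩, -, hj⟩ j
      by_cases h : j = i
      · subst h
        simp only [if_true]
        exact ⟨by linarith, by linarith⟩
      · simpa [h] using hj j h
    · intro h
      refine ⟨?_, by simp, fun j hj => ?_⟩
      · have := h i
        simp only [if_true] at this
        exact ⟨by linarith [this.1], by linarith [this.2]⟩
      · simpa [hj] using h j
  have h3 : volume (prismOver (EuclideanSpace.single i (1 : ℝ)) b s (openFacet s i b)) =
      ENNReal.ofReal s ^ n := by
    rw [h2, (PiLp.volume_preserving_ofLp (Fin n)).measure_preimage
      (MeasurableSet.univ_pi fun j => by split_ifs <;> exact measurableSet_Ioo).nullMeasurableSet,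
      volume_pi_pi]
    have : ∀ j : Fin n, volume (if j = i then Set.Ioo b (b + s) else Set.Ioo 0 s) =
        ENNReal.ofReal s := by
      intro j
      split_ifs <;> simp
    simp [this]
  rw [h3, finrank_euclideanSpace_fin] at h1
  have hn : n = (n - 1) + 1 := by have := i.pos; lia
  have h4 : ENNReal.ofReal s ^ n = ENNReal.ofReal s * ENNReal.ofReal s ^ (n - 1) := by
    conv_lhs => rw [hn, pow_succ']
  rw [h4] at h1
  rw [ENNReal.ofReal_pow hs.le]
  exact ((ENNReal.mul_right_inj (by simpa using hs) (by simp)).1 h1).symm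

theorem openFacet_subset_frontier {s b : ℝ} (hs : 0 < s) (hb : b = 0 ∨ b = s) (i : Fin n) :
    openFacet s i b ⊆ frontier {x : EuclideanSpace ℝ (Fin n) | ∀ i, x i ∈ Set.Icc 0 s} := by
  rintro x ⟨hxi, hx⟩
  refine ⟨subset_closure fun j => ?_, fun hint => ?_⟩
  · by_cases hj : j = i
    · subst hj
      rw [hxi]
      rcases hb with rfl | rfl <;> simp [hs.le]
    · exact Set.Ioo_subset_Icc_self (hx j hj)
  · obtain ⟨σ, hσ⟩ : ∃ σ : ℝ, ∀ t : ℝ, 0 < t → b + t * σ ∉ Set.Icc 0 s := by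
      rcases hb with rfl | rfl
      · exact ⟨-1, fun t ht h => by linarith [h.1]⟩
      · exact ⟨1, fun t ht h => by linarith [h.2]⟩
    have hcont : Tendsto (fun t : ℝ => x + t • EuclideanSpace.single i σ) (𝓝[>] 0) (𝓝 x) := by
      have : Continuous fun t : ℝ => x + t • EuclideanSpace.single i σ := by fun_prop
      simpa using (this.tendsto 0).mono_left nhdsWithin_le_nhds
    obtain ⟨t, ht, ht0⟩ := ((hcont.eventually (isOpen_interior.mem_nhds hint)).and
      self_mem_nhdsWithin).exists
    have := interior_subset ht i
    simp only [PiLp.add_apply, PiLp.smul_apply, PiLp.single_apply, if_true, hxi,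
      smul_eq_mul] at this
    exact hσ t ht0 this

/-- Relatively open facets are pairwise disjoint, so their areas add up. Only this lower bound is
needed for the comparison. -/
theorem le_surfaceArea_cube {s : ℝ} (hs : 0 < s) :
    2 * (n : ENNReal) * ENNReal.ofReal (s ^ (n - 1)) ≤
      surfaceArea {x : EuclideanSpace ℝ (Fin n) | ∀ i, x i ∈ Set.Icc 0 s} := by
  set I : Finset (Fin n × ℝ) := Finset.univ ×ˢ {0, s} with hI
  have hb : ∀ p ∈ I, p.2 = 0 ∨ p.2 = s := fun p hp => by simpa [hI] using hp
  have hdisj : (I : Set (Fin n × ℝ)).PairwiseDisjoint fun p => openFacet s p.1 p.2 := by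
    intro p hp q hq hpq
    refine Set.disjoint_left.2 fun x hx hx' => hpq ?_
    by_cases h : p.1 = q.1
    · refine Prod.ext h ?_
      rw [← hx.1, ← hx'.1, h]
    · have h1 := hx'.2 p.1 h
      rw [hx.1] at h1
      rcases hb p hp with h2 | h2 <;> rw [h2] at h1 <;> simp at h1
  calc 2 * (n : ENNReal) * ENNReal.ofReal (s ^ (n - 1))
      = ∑ p ∈ I, μHE[n - 1] (openFacet s p.1 p.2) := by
        simp_rw [euclideanHausdorffMeasure_openFacet hs]
        rw [Finset.sum_const, hI, Finset.card_product, Finset.card_pair hs.ne]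
        simp [mul_comm]
    _ = μHE[n - 1] (⋃ p ∈ I, openFacet s p.1 p.2) :=
        (measure_biUnion_finset hdisj fun p _ => measurableSet_openFacet s p.1 p.2).symm
    _ ≤ _ := measure_mono (Set.iUnion₂_subset fun p hp => openFacet_subset_frontier hs (hb p hp) _)

end Cube

/-! ### The reverse isoperimetric inequality -/

section ReverseIsoperimetric

variable {n : ℕ}

theorem InJohnPosition.volume_le {K : Set (EuclideanSpace ℝ (Fin n))} (hn : n ≠ 0)
    (hJ : InJohnPosition K) (hK : IsClosed K) (hc : Convex ℝ K) (hsymm : ∀ x ∈ K, -x ∈ K) :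
    volume K ≤ 2 ^ n := by
  obtain ⟨ι, _, u, c, h, hu⟩ := hJ.exists_isIdentityDecomposition hn hK hc hsymm
  simpa using h.volume_le_of_subset_slabs hu

/-- An affine image of a symmetric body is symmetric only about some centre `a`, whereas the volume
bound needs symmetry about 0. If `x` is in the unit ball, then `x` and `2a + x` lie in `K`, hence so
does their midpoint `a + x`: the unit ball about `a` also lies in `K`. -/
theorem InJohnPosition.vadd_of_symm {K : Set (EuclideanSpace ℝ (Fin n))}
    (hJ : InJohnPosition K) (hc : Convex ℝ K) {a : EuclideanSpace ℝ (Fin n)}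
    (ha : ∀ x ∈ K, (2 : ℝ) • a - x ∈ K) : InJohnPosition (-a +ᵥ K) := by
  refine ⟨fun x hx => ?_, ?_⟩
  · rw [Set.mem_vadd_set_iff_neg_vadd_mem, neg_neg, vadd_eq_add]
    have h1 := hJ.1 hx
    have h2 := ha _ (hJ.1 (show -x ∈ Metric.closedBall 0 1 by simpa using hx))
    have h3 := hc h1 h2 (a := 1 / 2) (b := 1 / 2) (by norm_num) (by norm_num) (by norm_num)
    convert h3 using 1
    module
  · rintro _ ⟨ψ, rfl⟩ hsub
    rw [← measure_vadd volume a]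
    refine hJ.2 _ ⟨ψ.trans (AffineEquiv.constVAdd ℝ _ a), ?_⟩ ?_
    · ext x
      simp [Set.mem_vadd_set]
    · intro x hx
      rw [Set.mem_vadd_set_iff_neg_vadd_mem] at hx
      have := hsub hx
      rwa [Set.mem_vadd_set_iff_neg_vadd_mem, neg_neg, vadd_neg_vadd] at this

theorem InJohnPosition.surfaceArea_le {K : Set (EuclideanSpace ℝ (Fin n))} (hn : n ≠ 0)
    (hJ : InJohnPosition K) (hK : IsCompact K) (hc : Convex ℝ K) {a : EuclideanSpace ℝ (Fin n)}
    (ha : ∀ x ∈ K, (2 : ℝ) • a - x ∈ K) :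
    surfaceArea K ≤ 2 * (n : ENNReal) * volume K ^ (((n : ℝ) - 1) / (n : ℝ)) := by
  have hn1 : (1 : ℝ) ≤ n := by exact_mod_cast Nat.one_le_iff_ne_zero.2 hn
  have hvol : volume K ≤ 2 ^ n := by
    rw [← measure_vadd volume (-a)]
    refine (hJ.vadd_of_symm hc ha).volume_le hn (hK.vadd _).isClosed (hc.vadd _) fun x hx => ?_
    rw [Set.mem_vadd_set_iff_neg_vadd_mem, neg_neg, vadd_eq_add] at hx ⊢
    convert ha _ hx using 1
    module
  have harea := euclideanHausdorffMeasure_frontier_le hK hc hJ.1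
  rw [finrank_euclideanSpace_fin] at harea
  have hroot : volume K ^ (1 / (n : ℝ)) ≤ 2 := by
    have h1 := ENNReal.rpow_le_rpow hvol (z := 1 / (n : ℝ)) (by positivity)
    rwa [← ENNReal.rpow_natCast, ← ENNReal.rpow_mul, mul_one_div_cancel (by positivity),
      ENNReal.rpow_one] at h1
  calc surfaceArea K ≤ n * volume K := harea
    _ = n * (volume K ^ (1 / (n : ℝ)) * volume K ^ (((n : ℝ) - 1) / (n : ℝ))) := by
        rw [← ENNReal.rpow_add_of_nonneg _ _ (by positivity) (div_nonneg (by linarith) (by linarith)),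
          ← add_div, add_sub_cancel, div_self (by positivity), ENNReal.rpow_one]
    _ ≤ n * (2 * volume K ^ (((n : ℝ) - 1) / (n : ℝ))) := by gcongr
    _ = _ := by ring

/-- A body satisfying the reverse isoperimetric inequality can be rescaled to have the volume of
a given cube, and then has at most its surface area. -/
theorem exists_smul_volume_eq_and_surfaceArea_le {K : Set (EuclideanSpace ℝ (Fin n))} (hn : n ≠ 0)
    (h0 : volume K ≠ 0) (htop : volume K ≠ ⊤)
    (hK : surfaceArea K ≤ 2 * (n : ENNReal) * volume K ^ (((n : ℝ) - 1) / (n : ℝ)))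
    {Q : Set (EuclideanSpace ℝ (Fin n))} (hQ : IsCube Q) :
    ∃ r : ℝ, 0 < r ∧ volume (r • K) = volume Q ∧ surfaceArea (r • K) ≤ surfaceArea Q := by
  obtain ⟨s, hs, g, rfl⟩ := hQ
  have hn1 : 1 ≤ n := Nat.one_le_iff_ne_zero.2 hn
  have hv : 0 < (volume K).toReal := ENNReal.toReal_pos h0 htop
  -- The side of a cube with the volume of `K`; the required dilation factor is `s / t`.
  set t : ℝ := (volume K).toReal ^ (1 / (n : ℝ)) with ht
  have htpos : 0 < t := Real.rpow_pos_of_pos hv _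
  have htn : t ^ n = (volume K).toReal := by
    rw [ht, one_div, Real.rpow_inv_natCast_pow hv.le hn]
  have hvol : volume K = ENNReal.ofReal (t ^ n) := by rw [htn, ENNReal.ofReal_toReal htop]
  have hpow : volume K ^ (((n : ℝ) - 1) / (n : ℝ)) = ENNReal.ofReal (t ^ (n - 1)) := by
    rw [hvol, ENNReal.ofReal_rpow_of_pos (by positivity), ← Real.rpow_natCast,
      ← Real.rpow_natCast, ← Real.rpow_mul htpos.le, mul_div_cancel₀ _ (by positivity),
      Nat.cast_sub hn1, Nat.cast_one]
  rw [hpow] at hK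
  refine ⟨s / t, by positivity, ?_, ?_⟩
  · rw [volume_affineIsometryEquiv_image, volume_cube hs.le, Measure.addHaar_smul,
      finrank_euclideanSpace_fin, abs_of_pos (by positivity), hvol,
      ← ENNReal.ofReal_mul (by positivity), ← mul_pow, div_mul_cancel₀ _ htpos.ne']
  · rw [surfaceArea_affineIsometryEquiv_image, surfaceArea_smul (by positivity)]
    refine le_trans ?_ (le_surfaceArea_cube hs)
    calc ENNReal.ofReal ((s / t) ^ (n - 1)) * surfaceArea K
        ≤ ENNReal.ofReal ((s / t) ^ (n - 1)) *
          (2 * (n : ENNReal) * ENNReal.ofReal (t ^ (n - 1))) := by gcongr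
      _ = 2 * (n : ENNReal) *
          (ENNReal.ofReal ((s / t) ^ (n - 1)) * ENNReal.ofReal (t ^ (n - 1))) := by ring
      _ = _ := by
        rw [← ENNReal.ofReal_mul (by positivity), ← mul_pow, div_mul_cancel₀ _ htpos.ne']

end ReverseIsoperimetric

theorem theorem2 (n : ℕ) (hn : 1 ≤ n)
    (C : ConvexBody (EuclideanSpace ℝ (Fin n)))
    (hC_int : (interior (C : Set (EuclideanSpace ℝ (Fin n)))).Nonempty)
    (hC_symm : ∀ x ∈ C, -x ∈ C) :
    (∀ Q : Set (EuclideanSpace ℝ (Fin n)), IsCube Q →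
      ∃ φ : EuclideanSpace ℝ (Fin n) ≃ᵃ[ℝ] EuclideanSpace ℝ (Fin n),
        volume (φ '' (C : Set (EuclideanSpace ℝ (Fin n)))) = volume Q ∧
        surfaceArea (φ '' (C : Set (EuclideanSpace ℝ (Fin n)))) ≤ surfaceArea Q) ∧
    (∃ φ : EuclideanSpace ℝ (Fin n) ≃ᵃ[ℝ] EuclideanSpace ℝ (Fin n),
      InJohnPosition (φ '' (C : Set (EuclideanSpace ℝ (Fin n))))) ∧
    (∀ φ : EuclideanSpace ℝ (Fin n) ≃ᵃ[ℝ] EuclideanSpace ℝ (Fin n),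
      InJohnPosition (φ '' (C : Set (EuclideanSpace ℝ (Fin n)))) →
        surfaceArea (φ '' (C : Set (EuclideanSpace ℝ (Fin n)))) ≤
          2 * (n : ENNReal) *
            volume (φ '' (C : Set (EuclideanSpace ℝ (Fin n)))) ^ (((n : ℝ) - 1) / (n : ℝ))) := by
  have hn0 : n ≠ 0 := by lia
  have hcompact : ∀ φ : EuclideanSpace ℝ (Fin n) ≃ᵃ[ℝ] EuclideanSpace ℝ (Fin n),
      IsCompact (φ '' (C : Set (EuclideanSpace ℝ (Fin n)))) := fun φ =>
    C.isCompact.image φ.toContinuousAffineEquiv.continuous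
  have hle : ∀ φ : EuclideanSpace ℝ (Fin n) ≃ᵃ[ℝ] EuclideanSpace ℝ (Fin n),
      InJohnPosition (φ '' (C : Set (EuclideanSpace ℝ (Fin n)))) →
        surfaceArea (φ '' (C : Set (EuclideanSpace ℝ (Fin n)))) ≤
          2 * (n : ENNReal) *
            volume (φ '' (C : Set (EuclideanSpace ℝ (Fin n)))) ^ (((n : ℝ) - 1) / (n : ℝ)) := by
    intro φ hφ
    -- Since `C = -C`, its image is symmetric about `φ 0`.
    refine hφ.surfaceArea_le hn0 (hcompact φ) (C.convex.affine_image φ.toAffineMap) (a := φ 0) ?_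
    rintro _ ⟨x, hx, rfl⟩
    refine ⟨-x, hC_symm x hx, ?_⟩
    rw [φ.apply_eq_linear_add x, φ.apply_eq_linear_add (-x), map_neg]
    module
  have hJohn := exists_inJohnPosition C.isCompact hC_int
  refine ⟨fun Q hQ => ?_, hJohn, hle⟩
  obtain ⟨φ, hφ⟩ := hJohn
  have h0 : volume (φ '' (C : Set (EuclideanSpace ℝ (Fin n)))) ≠ 0 :=
    ((Metric.measure_closedBall_pos volume _ one_pos).trans_le (measure_mono hφ.1)).ne'
  obtain ⟨r, hr, hvol, harea⟩ := exists_smul_volume_eq_and_surfaceArea_le hn0 h0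
    (hcompact φ).measure_lt_top.ne (hle φ hφ) hQ
  refine ⟨φ.trans (LinearEquiv.smulOfNeZero ℝ _ r hr.ne').toAffineEquiv, ?_⟩
  have himage : (φ.trans (LinearEquiv.smulOfNeZero ℝ _ r hr.ne').toAffineEquiv) ''
      (C : Set (EuclideanSpace ℝ (Fin n))) = r • (φ '' (C : Set (EuclideanSpace ℝ (Fin n)))) := by
    rw [← Set.image_smul, Set.image_image]
    rfl
  rw [himage]
  exact ⟨hvol, harea⟩
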